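/- Let $\Bbbk$ be an algebraically closed field of characteristic zero, let $r>a\ge 1$ be coprime integers, let $\omega\in\Bbbk^\times$ be a primitive $r$-th root of unity, and let $G\subset \mathrm{GL}(2,\Bbbk)$ be the cyclic group generated by $\mathrm{diag}(\omega,\omega^a)$, so that $\mathbb{A}^2_\Bbbk/G=\operatorname{Spec}\Bbbk[x,y]^G$. Write $$\frac ra=c_1-\cfrac{1}{c_2-\cfrac{1}{\cdots-\cfrac1{c_\ell}}}\qquad (c_1,\dots,c_\ell\ge 2).$$ Put $N=\mathbb{Z}^2+\mathbb{Z}\cdot\frac1r(1,a)$ and $M=\operatorname{Hom}(N,\mathbb{Z})=\{(p,q)\in\mathbb{Z}^2: r\mid p+aq\}$, and define $v_0=(0,1)$, $v_1=\frac1r(1,a)$, $v_{j+1}=c_jv_j-v_{j-1}$ for $1\le j\le \ell$, so that $v_{\ell+1}=(1,0)$. Let $X$ be the toric variety of the fan $\Sigma$ in $N\otimes\mathbb{Q}$ whose maximal cones are spanned by $v_j,v_{j+1}$ for $0\le j\le\ell$, and let $f\colon X\to\mathbb{A}^2_\Bbbk/G$ be the toric morphism induced by the inclusion of these cones in the nonnegative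 quadrant; it is the minimal resolution of $\mathbb{A}^2_\Bbbk/G$. Let $D_0,\dots,D_{\ell+1}$ be the torus-invariant prime divisors of $X$; those with $1\le j\le\ell$ are the exceptional curves. Let $L_0=\mathcal{O}_X$ and let $L_1,\dots,L_\ell\in\operatorname{Pic}(X)=\mathbb{Z}^{\Sigma(1)}/M$ be the line bundles with $\deg(L_i|_{D_j})=\delta_{ij}$ for $1\le i,j\le\ell$. Let $Q$ be the quiver of sections of $(L_0,\dots,L_\ell)$. Its vertices are $0,\dots,\ell$, and its arrows from $i$ to $j$ are the irreducible torus-invariant sections $s$ of $L_j\otimes L_i^{-1}$ up to scalar, that is, those with $\operatorname{div}(s)\ne0$ that are not a product of torus-invariant sections of $L_l\otimes L_i^{-1}$ and $L_j\otimes L_l^{-1}$ with nonzero divisors, for any vertex $l$. For an arrow $b$ from $i$ to $j$ put $\operatorname{inc}(b)=\chi_j-\chi_i\in\mathbb{Z}^{Q_0}$ and let $\operatorname{div}(b)\in\mathbb{N}^{\Sigma(1)}$ be the divisor of zeroes of its section. Let $\pi=(\operatorname{inc},\operatorname{div})$, extended additively to $\mathbb{N}^{Q_1}$, and $$I_Q=\big(y^u-y^v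 : u,v\in\mathbb{N}^{Q_1},\ \pi(u)=\pi(v)\big)\subset \Bbbk[y_b : b\in Q_1].$$ The ring $A=\Bbbk[y_b : b\in Q_1]/I_Q$ is graded by $\deg y_b=\operatorname{inc}(b)$, which gives the action of the torus $T_Q$ on $\mathbb{V}(I_Q)=\operatorname{Spec}A$. With $\vartheta=(-\ell,1,\dots,1)$, put $$\mathbb{V}(I_Q)/\!/_\vartheta T_Q=\operatorname{Proj}\Big(\bigoplus_{j\ge0}A_{j\vartheta}\Big),\qquad \mathbb{V}(I_Q)/T_Q=\operatorname{Spec}A_0.$$ Then the morphism $\mathbb{V}(I_Q)/\!/_\vartheta T_Q\to\mathbb{V}(I_Q)/T_Q$ obtained by variation of GIT quotient, that is, the structure morphism of $\operatorname{Proj}$, is projective, and it coincides with the minimal resolution $f\colon X\to\mathbb{A}^2_\Bbbk/G$. Precisely, there are an isomorphism of schemes $X\cong\mathbb{V}(I_Q)/\!/_\vartheta T_Q$ and an isomorphism $\mathbb{A}^2_\Bbbk/G\cong\mathbb{V}(I_Q)/T_Q$ of $\Bbbk$-schemes that identify $f$ with this morphism. The second isomorphism is given by the isomorphism of $\Bbbk$-algebras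 $A_0\to\Bbbk[x,y]^G$ induced by $y_b\mapsto x^{d_{\ell+1}}y^{d_0}$, where $\operatorname{div}(b)=\sum_j d_jD_j$. -/

import Mathlib

open CategoryTheory CategoryTheory.Limits AlgebraicGeometry

noncomputable section

/-- The value of the Jung-Hirzebruch continued fraction
`c₁ - 1 / (c₂ - 1 / (⋯ - 1 / c_ℓ))` of a list `[c₁, …, c_ℓ]`. -/
def jungHirzebruch : List ℕ → ℚ
  | [] => 0
  | [x] => x
  | x :: y :: l => x - 1 / jungHirzebruch (y :: l)

/-- The type `1/r (1, a)` of a cyclic quotient surface singularity, together with the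
Jung-Hirzebruch expansion of `r / a`. -/
structure CyclicQuotientType where
  /-- The order of the group. -/
  r : ℕ
  /-- The weight of the second coordinate. -/
  a : ℕ
  /-- The coefficients `c₁, …, c_ℓ` of the Jung-Hirzebruch continued fraction. -/
  c : List ℕ
  a_pos : 0 < a
  a_lt : a < r
  coprime : Nat.Coprime a r
  two_le : ∀ x ∈ c, 2 ≤ x
  expansion : (r : ℚ) / a = jungHirzebruch c

namespace CyclicQuotientType

variable (D : CyclicQuotientType)

/-- The number of exceptional curves. -/
abbrev ℓ : ℕ := D.c.length

/-- The coefficient `c_{j+1}` (zero if `j ≥ ℓ`). -/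
def coef (j : ℕ) : ℤ := (D.c.getD j 0 : ℕ)

/-- The vectors `(β_j, α_j) = r • v_j`, where `v_0, …, v_{ℓ+1}` are the primitive generators
of the rays of the fan, listed from `v_0 = (0, 1)` and `v_1 = (1, a) / r` to `v_{ℓ+1} = (1, 0)`
by the recursion `v_{j+1} = c_j v_j - v_{j-1}`. -/
def scaledRay : ℕ → ℤ × ℤ
  | 0 => (0, D.r)
  | 1 => (1, D.a)
  | (j + 2) => D.coef j • scaledRay (j + 1) - scaledRay j

/-- The lattice `M` dual to `N = ℤ² + ℤ (1, a) / r`: the exponents of the Laurent monomials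
`x ^ p * y ^ q` for which `p + a q` is divisible by `r`. -/
def latticeM : AddSubgroup (ℤ × ℤ) where
  carrier := {m | (D.r : ℤ) ∣ m.1 + D.a * m.2}
  zero_mem' := by simp
  add_mem' := by
    intro m n hm hn
    change (D.r : ℤ) ∣ (m.1 + n.1) + D.a * (m.2 + n.2)
    exact (dvd_add hm hn).trans (dvd_of_eq (by ring))
  neg_mem' := by
    intro m hm
    change (D.r : ℤ) ∣ -m.1 + D.a * (-m.2)
    exact ((dvd_neg (α := ℤ)).mpr hm).trans (dvd_of_eq (by ring))

/-- The pairing `r * ⟨m, v_j⟩`. -/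
def pair (j : ℕ) : ℤ × ℤ →+ ℤ where
  toFun m := m.1 * (D.scaledRay j).1 + m.2 * (D.scaledRay j).2
  map_zero' := by simp
  map_add' m n := by simp only [Prod.fst_add, Prod.snd_add]; ring

lemma pair_apply (j : ℕ) (m : ℤ × ℤ) :
    D.pair j m = m.1 * (D.scaledRay j).1 + m.2 * (D.scaledRay j).2 := rfl

lemma r_pos : 0 < D.r := lt_trans D.a_pos D.a_lt

lemma scaledRay_det (j : ℕ) :
    (D.scaledRay (j + 1)).1 * (D.scaledRay j).2 - (D.scaledRay (j + 1)).2 * (D.scaledRay j).1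
      = D.r := by
  induction j with
  | zero => simp [scaledRay]
  | succ j ih =>
    simp only [scaledRay, Prod.fst_sub, Prod.snd_sub, Prod.smul_fst, Prod.smul_snd, smul_eq_mul]
    linarith

lemma scaledRay_dvd (j : ℕ) :
    (D.r : ℤ) ∣ (D.scaledRay j).2 - D.a * (D.scaledRay j).1 := by
  induction j using Nat.twoStepInduction with
  | zero => simp [scaledRay]
  | one => simp [scaledRay]
  | more j h0 h1 =>
    simp only [scaledRay, Prod.fst_sub, Prod.snd_sub, Prod.smul_fst, Prod.smul_snd, smul_eq_mul]
    exact (dvd_sub (Dvd.dvd.mul_left h1 (D.coef j)) h0).trans (dvd_of_eq (by ring))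

lemma coef_eq (j : ℕ) (hj : j < D.c.length) : D.coef j = (D.c[j] : ℕ) := by
  simp [coef, List.getD_eq_getElem?_getD, List.getElem?_eq_getElem hj]

lemma one_lt_jungHirzebruch (l : List ℕ) (hl : l ≠ []) (h : ∀ x ∈ l, 2 ≤ x) :
    1 < jungHirzebruch l := by
  induction l with
  | nil => exact absurd rfl hl
  | cons x t ih =>
    have hx : (2 : ℚ) ≤ x := by exact_mod_cast h x (by simp)
    cases t with
    | nil => simp only [jungHirzebruch]; linarith
    | cons y t =>
      have h1 := ih (by simp) (fun z hz => h z (by simp [hz]))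
      have h2 : 1 / jungHirzebruch (y :: t) < 1 := by
        rw [div_lt_one (by linarith)]; exact h1
      simp only [jungHirzebruch]; linarith

lemma scaledRay_snd_aux (j : ℕ) (hj : j < D.ℓ) :
    0 < (D.scaledRay (j + 1)).2 ∧
      ((D.scaledRay j).2 : ℚ) = jungHirzebruch (D.c.drop j) * (D.scaledRay (j + 1)).2 := by
  induction j with
  | zero =>
    have ha : (D.a : ℚ) ≠ 0 := by exact_mod_cast D.a_pos.ne'
    refine ⟨by simpa [scaledRay] using D.a_pos, ?_⟩
    simp only [scaledRay, List.drop_zero, ← D.expansion, Int.cast_natCast]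
    field_simp
  | succ j ih =>
    obtain ⟨h0, h1⟩ := ih (by omega)
    have hjc : j < D.c.length := Nat.lt_of_succ_lt hj
    have hd : D.c.drop j = D.c[j] :: D.c.drop (j + 1) := List.drop_eq_getElem_cons hjc
    have hne : D.c.drop (j + 1) ≠ [] := by simp; omega
    have hgt := one_lt_jungHirzebruch (D.c.drop (j + 1)) hne
      (fun x hx => D.two_le x (List.mem_of_mem_drop hx))
    have hco : D.coef j = (D.c[j] : ℕ) := D.coef_eq _ _
    obtain ⟨y, t, hyt⟩ := List.exists_cons_of_ne_nil hne
    have hval : jungHirzebruch (D.c.drop j) = D.coef j - 1 / jungHirzebruch (D.c.drop (j + 1)) := by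
      rw [hd, hyt, hco]; simp [jungHirzebruch]
    have key : ((D.scaledRay (j + 2)).2 : ℚ)
        = (D.scaledRay (j + 1)).2 / jungHirzebruch (D.c.drop (j + 1)) := by
      simp only [scaledRay, Prod.snd_sub, Prod.smul_snd, smul_eq_mul]
      push_cast
      rw [h1, hval]
      ring
    have h0q : (0 : ℚ) < (D.scaledRay (j + 1)).2 := by exact_mod_cast h0
    refine ⟨?_, ?_⟩
    · have : (0 : ℚ) < ((D.scaledRay (j + 2)).2 : ℚ) := by
        rw [key]; exact div_pos h0q (by linarith)
      exact_mod_cast this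
    · rw [key]
      field_simp

lemma c_ne_nil : D.c ≠ [] := by
  intro h
  have h1 := D.expansion
  have hr : (D.r : ℚ) ≠ 0 := by exact_mod_cast D.r_pos.ne'
  have ha : (D.a : ℚ) ≠ 0 := by exact_mod_cast D.a_pos.ne'
  rw [h, jungHirzebruch] at h1
  exact (div_ne_zero hr ha) h1

lemma scaledRay_last_snd : (D.scaledRay (D.ℓ + 1)).2 = 0 := by
  have hl : 0 < D.ℓ := List.length_pos_of_ne_nil D.c_ne_nil
  obtain ⟨n, hn⟩ : ∃ n, D.ℓ = n + 1 := ⟨D.ℓ - 1, by omega⟩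
  obtain ⟨h0, h1⟩ := D.scaledRay_snd_aux n (by omega)
  have hnc : D.c.length = n + 1 := hn
  have hd : D.c.drop n = [D.c[n]] := by
    rw [List.drop_eq_getElem_cons (by omega), List.drop_of_length_le (by omega)]
  have hco : D.coef n = (D.c[n] : ℕ) := D.coef_eq _ _
  rw [hd, jungHirzebruch] at h1
  have h2 : (D.scaledRay n).2 = D.coef n * (D.scaledRay (n + 1)).2 := by
    rw [hco]; exact_mod_cast h1
  rw [hn]
  simp only [scaledRay, Prod.snd_sub, Prod.smul_snd, smul_eq_mul]
  linarith

lemma scaledRay_snd_nonneg (j : ℕ) (hj : j ≤ D.ℓ + 1) : 0 ≤ (D.scaledRay j).2 := by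
  rcases Nat.lt_or_ge j (D.ℓ + 1) with h | h
  · cases j with
    | zero => simp [scaledRay]
    | succ j => exact (D.scaledRay_snd_aux j (by omega)).1.le
  · rw [show j = D.ℓ + 1 by omega, scaledRay_last_snd]

lemma scaledRay_fst_aux (j : ℕ) (hj : j ≤ D.ℓ) :
    0 ≤ (D.scaledRay j).1 ∧ (D.scaledRay j).1 ≤ (D.scaledRay (j + 1)).1 := by
  induction j with
  | zero => simp [scaledRay]
  | succ j ih =>
    obtain ⟨h0, h1⟩ := ih (by omega)
    have hjc : j < D.c.length := hj
    have hco : D.coef j = (D.c[j] : ℕ) := D.coef_eq _ _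
    have h2 : (2 : ℤ) ≤ D.coef j := by
      rw [hco]; exact_mod_cast D.two_le _ (List.getElem_mem _)
    refine ⟨h0.trans h1, ?_⟩
    simp only [scaledRay, Prod.fst_sub, Prod.smul_fst, smul_eq_mul]
    nlinarith

lemma scaledRay_fst_nonneg (j : ℕ) (hj : j ≤ D.ℓ + 1) : 0 ≤ (D.scaledRay j).1 := by
  cases j with
  | zero => simp [scaledRay]
  | succ j => exact (D.scaledRay_fst_aux j (by omega)).1.trans (D.scaledRay_fst_aux j (by omega)).2

/-- The set `Σ(1)` of rays. -/
abbrev Ray : Type := Fin (D.ℓ + 2)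

/-- The cones of the fan: the faces of the cones spanned by two consecutive rays. A cone is
identified with the set of its rays. -/
def IsCone (s : Finset D.Ray) : Prop :=
  ∃ i : Fin (D.ℓ + 1), s ⊆ {i.castSucc, i.succ}

/-- The fan, partially ordered by the relation of being a face. -/
abbrev Fan : Type := {s : Finset D.Ray // D.IsCone s}

/-- The semigroup `M ∩ σ^∨` of a cone `σ`. -/
def dualSemigroup (s : Finset D.Ray) : AddSubmonoid (ℤ × ℤ) where
  carrier := {m | m ∈ D.latticeM ∧ ∀ ρ ∈ s, 0 ≤ D.pair ρ m}
  zero_mem' := ⟨D.latticeM.zero_mem, by simp⟩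
  add_mem' := by
    rintro m n ⟨hm, hm1⟩ ⟨hn, hn1⟩
    refine ⟨D.latticeM.add_mem hm hn, fun ρ hρ => ?_⟩
    rw [map_add]
    exact add_nonneg (hm1 ρ hρ) (hn1 ρ hρ)

lemma dualSemigroup_anti {s t : Finset D.Ray} (h : s ⊆ t) :
    D.dualSemigroup t ≤ D.dualSemigroup s :=
  fun _ hm => ⟨hm.1, fun ρ hρ => hm.2 ρ (h hρ)⟩

lemma exists_face (s : Finset D.Ray) (t : D.Fan) (h : s ⊆ t.1) :
    ∃ u : D.dualSemigroup t.1, (∀ ρ ∈ s, D.pair ρ u.1 = 0) ∧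
      ∀ ρ ∈ t.1, ρ ∉ s → 0 < D.pair ρ u.1 := by
  classical
  obtain ⟨t, i, hi⟩ := t
  have hr : (0 : ℤ) < D.r := by exact_mod_cast D.r_pos
  have hdet := D.scaledRay_det i
  set w := D.scaledRay i with hw
  set z := D.scaledRay (i + 1) with hz
  have hd1 := D.scaledRay_dvd i
  have hd2 := D.scaledRay_dvd (i + 1)
  rw [← hw] at hd1
  rw [← hz] at hd2
  let e : ℤ × ℤ := (-z.2, z.1)
  let f : ℤ × ℤ := (w.2, -w.1)
  have he : e ∈ D.latticeM := by
    change (D.r : ℤ) ∣ -z.2 + D.a * z.1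
    exact ((dvd_neg (α := ℤ)).mpr hd2).trans (dvd_of_eq (by ring))
  have hf : f ∈ D.latticeM := by
    change (D.r : ℤ) ∣ w.2 + D.a * (-w.1)
    exact hd1.trans (dvd_of_eq (by ring))
  let u : ℤ × ℤ := (if i.castSucc ∈ s then 0 else e) + (if i.succ ∈ s then 0 else f)
  have hu : u ∈ D.latticeM := by
    refine D.latticeM.add_mem ?_ ?_
    · split_ifs
      exacts [D.latticeM.zero_mem, he]
    · split_ifs
      exacts [D.latticeM.zero_mem, hf]
  have h1e : D.pair i e = D.r := by rw [pair_apply, ← hw]; simp only [e]; linarith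
  have h1f : D.pair i f = 0 := by rw [pair_apply, ← hw]; simp only [f]; ring
  have h2e : D.pair (i + 1) e = 0 := by rw [pair_apply, ← hz]; simp only [e]; ring
  have h2f : D.pair (i + 1) f = D.r := by rw [pair_apply, ← hz]; simp only [f]; linarith
  have hp1 : D.pair (i.castSucc : D.Ray) u = if i.castSucc ∈ s then 0 else (D.r : ℤ) := by
    simp only [u, map_add, Fin.val_castSucc]
    split_ifs <;> simp [h1e, h1f]
  have hp2 : D.pair (i.succ : D.Ray) u = if i.succ ∈ s then 0 else (D.r : ℤ) := by
    simp only [u, map_add, Fin.val_succ]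
    split_ifs <;> simp [h2e, h2f]
  have hmain : ∀ ρ ∈ t, D.pair ρ u = if ρ ∈ s then 0 else (D.r : ℤ) := by
    intro ρ hρ
    have h3 := hi hρ
    simp only [Finset.mem_insert, Finset.mem_singleton] at h3
    rcases h3 with rfl | rfl
    exacts [hp1, hp2]
  refine ⟨⟨u, hu, fun ρ hρ => ?_⟩, fun ρ hρ => ?_, fun ρ hρ hn => ?_⟩
  · rw [hmain ρ hρ]
    split_ifs
    exacts [le_rfl, hr.le]
  · simp [hmain ρ (h hρ), hρ]
  · simpa [hmain ρ hρ, hn] using D.r_pos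

end CyclicQuotientType

namespace CyclicQuotientType

variable (k : Type*) [Field k] (D : CyclicQuotientType)

/-- The coordinate ring `k[M ∩ σ^∨]` of the affine toric chart of a cone `σ`. -/
abbrev ChartRing (s : Finset D.Ray) : Type _ := AddMonoidAlgebra k (D.dualSemigroup s)

/-- The inclusion `k[M ∩ σ^∨] → k[M ∩ τ^∨]` for a face `τ` of `σ`. -/
def chartMap {s t : Finset D.Ray} (h : s ⊆ t) : D.ChartRing k t →+* D.ChartRing k s :=
  AddMonoidAlgebra.mapDomainRingHom k (AddSubmonoid.inclusion (D.dualSemigroup_anti h))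

lemma chartMap_single {s t : Finset D.Ray} (h : s ⊆ t) (m : D.dualSemigroup t) (x : k) :
    D.chartMap k h (AddMonoidAlgebra.single m x) =
      AddMonoidAlgebra.single (AddSubmonoid.inclusion (D.dualSemigroup_anti h) m) x := by
  simp [chartMap]

lemma chartMap_injective {s t : Finset D.Ray} (h : s ⊆ t) :
    Function.Injective (D.chartMap k h) :=
  AddMonoidAlgebra.mapDomain_injective (AddSubmonoid.inclusion_injective _)

lemma isLocalization_chartMap {s t : Finset D.Ray} (h : s ⊆ t) (u : D.dualSemigroup t)
    (h0 : ∀ ρ ∈ s, D.pair ρ u.1 = 0) (h1 : ∀ ρ ∈ t, ρ ∉ s → 0 < D.pair ρ u.1) :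
    let _ := (D.chartMap k h).toAlgebra
    IsLocalization.Away (AddMonoidAlgebra.single u (1 : k)) (D.ChartRing k s) := by
  let _ := (D.chartMap k h).toAlgebra
  have hneg : -u.1 ∈ D.dualSemigroup s :=
    ⟨D.latticeM.neg_mem u.2.1, fun ρ hρ => by rw [map_neg, h0 ρ hρ, neg_zero]⟩
  have hbound : ∀ m : D.dualSemigroup s, ∃ n : ℕ, ∀ N ≥ n, m.1 + N • u.1 ∈ D.dualSemigroup t := by
    intro m
    refine ⟨∑ ρ ∈ t, (D.pair ρ m.1).natAbs, fun N hN => ⟨?_, fun ρ hρ => ?_⟩⟩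
    · exact D.latticeM.add_mem m.2.1 (D.latticeM.nsmul_mem u.2.1 N)
    · rw [map_add, map_nsmul]
      by_cases hs : ρ ∈ s
      · rw [h0 ρ hs, smul_zero, add_zero]; exact m.2.2 ρ hs
      · have h2 := h1 ρ hρ hs
        have h3 : (D.pair ρ m.1).natAbs ≤ N :=
          (Finset.single_le_sum (f := fun ρ : D.Ray => (D.pair ρ m.1).natAbs)
            (fun _ _ => Nat.zero_le _) hρ).trans hN
        have h4 : -(N : ℤ) ≤ D.pair ρ m.1 := by omega
        have h5 : (N : ℤ) ≤ N * D.pair ρ u.1 := by nlinarith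
        rw [nsmul_eq_mul]
        linarith
  have hmap : ∀ (m : D.dualSemigroup t) (x : k),
      algebraMap (D.ChartRing k t) (D.ChartRing k s) (AddMonoidAlgebra.single m x) =
        AddMonoidAlgebra.single (AddSubmonoid.inclusion (D.dualSemigroup_anti h) m) x :=
    D.chartMap_single k h
  refine IsLocalization.Away.mk (AddMonoidAlgebra.single u (1 : k)) ?_ ?_ ?_
  · rw [hmap]
    refine IsUnit.of_mul_eq_one (AddMonoidAlgebra.single ⟨-u.1, hneg⟩ 1) ?_
    rw [AddMonoidAlgebra.single_mul_single, AddMonoidAlgebra.one_def]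
    congr 1
    · exact Subtype.ext (add_neg_cancel u.1)
    · exact one_mul 1
  · intro z
    rw [hmap]
    induction z using AddMonoidAlgebra.induction_linear with
    | zero => exact ⟨0, 0, by simp⟩
    | add p q hp hq =>
      obtain ⟨n, b, hb⟩ := hp
      obtain ⟨n', b', hb'⟩ := hq
      refine ⟨n + n', b * AddMonoidAlgebra.single u 1 ^ n' +
        b' * AddMonoidAlgebra.single u 1 ^ n, ?_⟩
      rw [map_add, map_mul, map_mul, map_pow, map_pow, hmap, ← hb, ← hb']
      ring
    | single m x =>
      obtain ⟨n, hn⟩ := hbound m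
      refine ⟨n, AddMonoidAlgebra.single ⟨m.1 + n • u.1, hn n le_rfl⟩ x, ?_⟩
      rw [hmap, AddMonoidAlgebra.single_pow, AddMonoidAlgebra.single_mul_single, one_pow, mul_one]
      congr 1
  · intro p q hpq
    exact ⟨0, by rw [D.chartMap_injective k h hpq]⟩

/-- The diagram of the affine toric charts `U_σ = Spec k[M ∩ σ^∨]`, indexed by the fan. -/
def chartFunctor : D.Fan ⥤ Scheme where
  obj s := Spec (CommRingCat.of (D.ChartRing k s.1))
  map h := Spec.map (CommRingCat.ofHom (D.chartMap k (leOfHom h)))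
  map_id s := by
    rw [← Spec.map_id]
    congr 1
    refine CommRingCat.hom_ext (RingHom.ext fun x => ?_)
    induction x using AddMonoidAlgebra.induction_linear with
    | zero => simp
    | add p q hp hq => simp only [map_add, hp, hq]
    | single m x => exact D.chartMap_single k subset_rfl m x
  map_comp f g := by
    rw [← Spec.map_comp]
    congr 1
    refine CommRingCat.hom_ext (RingHom.ext fun x => ?_)
    induction x using AddMonoidAlgebra.induction_linear with
    | zero => simp
    | add p q hp hq => simp only [map_add, hp, hq]
    | single m x =>
      simp only [CommRingCat.hom_ofHom, CommRingCat.hom_comp, RingHom.comp_apply, chartMap_single]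
      rfl

instance chartFunctor_isOpenImmersion {s t : D.Fan} (h : s ⟶ t) :
    IsOpenImmersion ((D.chartFunctor k).map h) := by
  obtain ⟨u, h0, h1⟩ := D.exists_face s.1 t (leOfHom h)
  let _ := (D.chartMap k (leOfHom h)).toAlgebra
  have := D.isLocalization_chartMap k (leOfHom h) u h0 h1
  exact IsOpenImmersion.of_isLocalization (S := D.ChartRing k s.1)
    (AddMonoidAlgebra.single u (1 : k))

lemma range_chartFunctor_map {s t : D.Fan} (h : s ⟶ t) (u : D.dualSemigroup t.1)
    (h0 : ∀ ρ ∈ s.1, D.pair ρ u.1 = 0) (h1 : ∀ ρ ∈ t.1, ρ ∉ s.1 → 0 < D.pair ρ u.1) :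
    Set.range ((D.chartFunctor k).map h) =
      (PrimeSpectrum.basicOpen (AddMonoidAlgebra.single u (1 : k)) :
        Set (PrimeSpectrum (D.ChartRing k t.1))) := by
  let _ := (D.chartMap k (leOfHom h)).toAlgebra
  have := D.isLocalization_chartMap k (leOfHom h) u h0 h1
  exact PrimeSpectrum.localization_away_comap_range (D.ChartRing k s.1)
    (AddMonoidAlgebra.single u (1 : k))

instance chartFunctor_isLocallyDirected :
    (D.chartFunctor k ⋙ Scheme.forget).IsLocallyDirected where
  cond {s s' t} h h' x x' hx := by
    obtain ⟨u, h0, h1⟩ := D.exists_face s.1 t (leOfHom h)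
    obtain ⟨u', h0', h1'⟩ := D.exists_face s'.1 t (leOfHom h')
    let l : D.Fan := ⟨s.1 ∩ s'.1, by
      obtain ⟨i, hi⟩ := s.2
      exact ⟨i, Finset.inter_subset_left.trans hi⟩⟩
    let fl : l ⟶ s := homOfLE (Finset.inter_subset_left : s.1 ∩ s'.1 ⊆ s.1)
    let fl' : l ⟶ s' := homOfLE (Finset.inter_subset_right : s.1 ∩ s'.1 ⊆ s'.1)
    have hx2 : (D.chartFunctor k).map h x = (D.chartFunctor k).map h' x' := hx
    have hr := D.range_chartFunctor_map k h u h0 h1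
    have hr' := D.range_chartFunctor_map k h' u' h0' h1'
    have hl := D.range_chartFunctor_map k (fl ≫ h) (u + u')
      (fun ρ hρ => by
        have hρ2 := Finset.mem_inter.mp hρ
        have e1 := h0 ρ hρ2.1
        have e2 := h0' ρ hρ2.2
        rw [AddSubmonoid.coe_add, map_add, e1, e2, add_zero])
      (fun ρ hρ hn => by
        have n1 := u.2.2 ρ hρ
        have n2 := u'.2.2 ρ hρ
        rw [AddSubmonoid.coe_add, map_add]
        by_cases hs : ρ ∈ s.1
        · have hs' : ρ ∉ s'.1 := fun hs' => hn (Finset.mem_inter.mpr ⟨hs, hs'⟩)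
          linarith [h1' ρ hρ hs']
        · linarith [h1 ρ hρ hs])
    have hmem : (D.chartFunctor k).map h x ∈ Set.range ((D.chartFunctor k).map (fl ≫ h)) := by
      have e1 : (D.chartFunctor k).map h x ∈ Set.range ((D.chartFunctor k).map h) := ⟨x, rfl⟩
      have e2 : (D.chartFunctor k).map h x ∈ Set.range ((D.chartFunctor k).map h') :=
        ⟨x', hx2.symm⟩
      rw [hr] at e1
      rw [hr'] at e2
      rw [hl]
      have e3 : (AddMonoidAlgebra.single (u + u') (1 : k) : D.ChartRing k t.1) =
          AddMonoidAlgebra.single u 1 * AddMonoidAlgebra.single u' 1 := by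
        rw [AddMonoidAlgebra.single_mul_single, one_mul]
      rw [e3, PrimeSpectrum.basicOpen_mul]
      exact ⟨e1, e2⟩
    obtain ⟨y, hy⟩ := hmem
    have hcomm : fl ≫ h = fl' ≫ h' := Subsingleton.elim _ _
    refine ⟨l, fl, fl', y, ?_, ?_⟩
    · apply ((D.chartFunctor k).map h).isOpenEmbedding.injective
      change (D.chartFunctor k).map h ((D.chartFunctor k).map fl y) = _
      rw [← Scheme.Hom.comp_apply, ← Functor.map_comp, hy]
    · apply ((D.chartFunctor k).map h').isOpenEmbedding.injective
      change (D.chartFunctor k).map h' ((D.chartFunctor k).map fl' y) = _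
      rw [← Scheme.Hom.comp_apply, ← Functor.map_comp, ← hcomm, hy, hx2]

/-- The toric variety `X` of the fan, obtained by gluing the charts `U_σ` along the charts of
common faces. It is the minimal resolution of the quotient of the plane by the cyclic group. -/
def toricSurface : Scheme := colimit (D.chartFunctor k)

end CyclicQuotientType

/-- The ring `k[x, y]^G` of polynomials invariant under a group `G` of linear substitutions;
here `x = X 0` and `y = X 1`. -/
def invariantRing {k : Type*} [Field k] (G : Subgroup (Matrix.GeneralLinearGroup (Fin 2) k)) :
    Subalgebra k (MvPolynomial (Fin 2) k) where
  carrier := {P | ∀ g ∈ G, MvPolynomial.aeval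
    (fun i => ∑ j, MvPolynomial.C ((g : Matrix (Fin 2) (Fin 2) k) i j) * MvPolynomial.X j) P = P}
  mul_mem' hP hQ g hg := by rw [map_mul, hP g hg, hQ g hg]
  add_mem' hP hQ g hg := by rw [map_add, hP g hg, hQ g hg]
  algebraMap_mem' x g _ := by simp

/-- The quotient `𝔸² / G = Spec k[x, y]^G`. -/
def planeQuotient {k : Type*} [Field k] (G : Subgroup (Matrix.GeneralLinearGroup (Fin 2) k)) :
    Scheme :=
  Spec (CommRingCat.of (invariantRing G))

namespace CyclicQuotientType

variable {k : Type*} [Field k] (D : CyclicQuotientType)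

/-- The cyclic group generated by the diagonal matrix `diag(ω, ω ^ a)`. -/
def group (ω : kˣ) : Subgroup (Matrix.GeneralLinearGroup (Fin 2) k) :=
  Subgroup.zpowers
    { val := Matrix.diagonal ![(ω : k), (ω : k) ^ D.a]
      inv := Matrix.diagonal ![((ω⁻¹ : kˣ) : k), ((ω⁻¹ : kˣ) : k) ^ D.a]
      val_inv := by
        rw [Matrix.diagonal_mul_diagonal, ← Matrix.diagonal_one]
        congr 1
        ext i
        fin_cases i <;> simp
      inv_val := by
        rw [Matrix.diagonal_mul_diagonal, ← Matrix.diagonal_one]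
        congr 1
        ext i
        fin_cases i <;> simp }

/-- The inclusion of `k[x, y]` into the ring of Laurent polynomials. -/
def toLaurent : MvPolynomial (Fin 2) k →ₐ[k] AddMonoidAlgebra k (ℤ × ℤ) :=
  MvPolynomial.aeval
    ![AddMonoidAlgebra.single ((1, 0) : ℤ × ℤ) 1, AddMonoidAlgebra.single ((0, 1) : ℤ × ℤ) 1]

/-- The inclusion of the coordinate ring of a chart into the ring of Laurent polynomials. -/
def chartToLaurent (s : Finset D.Ray) : D.ChartRing k s →ₐ[k] AddMonoidAlgebra k (ℤ × ℤ) :=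
  AddMonoidAlgebra.mapDomainAlgHom k k (D.dualSemigroup s).subtype

lemma chartToLaurent_single (s : Finset D.Ray) (m : D.dualSemigroup s) (x : k) :
    D.chartToLaurent s (AddMonoidAlgebra.single m x) = AddMonoidAlgebra.single m.1 x := by
  simp [chartToLaurent]

lemma chartToLaurent_injective (s : Finset D.Ray) :
    Function.Injective (D.chartToLaurent (k := k) s) :=
  AddMonoidAlgebra.mapDomain_injective Subtype.val_injective

lemma chartToLaurent_chartMap {s t : Finset D.Ray} (h : s ⊆ t) (z : D.ChartRing k t) :
    D.chartToLaurent s (D.chartMap k h z) = D.chartToLaurent t z := by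
  induction z using AddMonoidAlgebra.induction_linear with
  | zero => simp
  | add p q hp hq => simp only [map_add, hp, hq]
  | single m x => rw [chartMap_single, chartToLaurent_single, chartToLaurent_single]; rfl

lemma toLaurent_monomial (m : Fin 2 →₀ ℕ) (x : k) :
    toLaurent (MvPolynomial.monomial m x) =
      AddMonoidAlgebra.single ((m 0, m 1) : ℤ × ℤ) x := by
  rw [toLaurent, MvPolynomial.aeval_monomial, Finsupp.prod_fintype _ _ (by simp)]
  simp [AddMonoidAlgebra.single_pow, AddMonoidAlgebra.single_mul_single,
    AddMonoidAlgebra.coe_algebraMap]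

lemma coeff_aeval_diagonal (w : Fin 2 → k) (P : MvPolynomial (Fin 2) k) (m : Fin 2 →₀ ℕ) :
    (MvPolynomial.aeval (fun i => ∑ j, MvPolynomial.C (Matrix.diagonal w i j) *
      MvPolynomial.X j) P : MvPolynomial (Fin 2) k).coeff m =
      w 0 ^ m 0 * w 1 ^ m 1 * P.coeff m := by
  induction P using MvPolynomial.induction_on' with
  | monomial n x =>
    rw [MvPolynomial.aeval_monomial, Finsupp.prod_fintype _ _ (by simp)]
    have e : (algebraMap k (MvPolynomial (Fin 2) k) x * ∏ i, (∑ j, MvPolynomial.C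
        (Matrix.diagonal w i j) * MvPolynomial.X j) ^ n i : MvPolynomial (Fin 2) k) =
        MvPolynomial.C (w 0 ^ n 0 * w 1 ^ n 1) * MvPolynomial.monomial n x := by
      rw [MvPolynomial.monomial_eq, Finsupp.prod_fintype _ _ (by simp)]
      simp [Fin.prod_univ_two, Fin.sum_univ_two, mul_pow, MvPolynomial.algebraMap_eq]
      ring
    rw [e, MvPolynomial.coeff_C_mul, MvPolynomial.coeff_monomial]
    split_ifs with h
    · rw [h]
    · simp
  | add p q hp hq => rw [map_add, MvPolynomial.coeff_add, hp, hq, MvPolynomial.coeff_add, mul_add]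

lemma dvd_of_mem_support {ω : kˣ} (hω : IsPrimitiveRoot ω D.r) {P : MvPolynomial (Fin 2) k}
    (hP : P ∈ invariantRing (D.group ω)) {m : Fin 2 →₀ ℕ} (hm : m ∈ P.support) :
    (D.r : ℤ) ∣ (m 0 : ℤ) + D.a * (m 1 : ℤ) := by
  have h1 := congrArg (MvPolynomial.coeff m) (hP _ (Subgroup.mem_zpowers _))
  rw [coeff_aeval_diagonal] at h1
  have h2 : (ω : k) ^ m 0 * ((ω : k) ^ D.a) ^ m 1 = 1 :=
    mul_right_cancel₀ (MvPolynomial.mem_support_iff.mp hm) (h1.trans (one_mul _).symm)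
  have h3 : ω ^ (m 0 + D.a * m 1) = 1 := by
    apply Units.ext
    rw [pow_add, pow_mul]
    push_cast
    exact h2
  exact_mod_cast hω.dvd_of_pow_eq_one _ h3

lemma mem_dualSemigroup_of_mem_support {ω : kˣ} (hω : IsPrimitiveRoot ω D.r)
    {P : MvPolynomial (Fin 2) k} (hP : P ∈ invariantRing (D.group ω)) {m : Fin 2 →₀ ℕ}
    (hm : m ∈ P.support) (s : Finset D.Ray) :
    ((m 0, m 1) : ℤ × ℤ) ∈ D.dualSemigroup s := by
  refine ⟨D.dvd_of_mem_support hω hP hm, fun ρ _ => ?_⟩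
  have h1 := D.scaledRay_fst_nonneg ρ (by have := ρ.2; omega)
  have h2 := D.scaledRay_snd_nonneg ρ (by have := ρ.2; omega)
  rw [pair_apply]
  positivity

lemma toLaurent_mem_range {ω : kˣ} (hω : IsPrimitiveRoot ω D.r) (s : Finset D.Ray)
    (P : invariantRing (D.group ω)) :
    (toLaurent.comp (invariantRing (D.group ω)).val) P ∈ (D.chartToLaurent (k := k) s).range := by
  change toLaurent P.1 ∈ _
  rw [P.1.as_sum, map_sum]
  refine Subalgebra.sum_mem _ fun m hm => ?_
  rw [toLaurent_monomial]
  exact ⟨AddMonoidAlgebra.single ⟨_, D.mem_dualSemigroup_of_mem_support hω P.2 hm s⟩ _,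
    D.chartToLaurent_single s _ _⟩

/-- The inclusion `k[x, y]^G → k[M ∩ σ^∨]`, compatible with the inclusions of both sides into
the ring of Laurent polynomials. -/
def invariantToChart {ω : kˣ} (hω : IsPrimitiveRoot ω D.r) (s : Finset D.Ray) :
    invariantRing (D.group ω) →ₐ[k] D.ChartRing k s :=
  (AlgEquiv.ofInjective (D.chartToLaurent (k := k) s)
    (D.chartToLaurent_injective s)).symm.toAlgHom.comp
    ((toLaurent.comp (invariantRing (D.group ω)).val).codRestrict (D.chartToLaurent s).range
      (D.toLaurent_mem_range hω s))

lemma chartToLaurent_invariantToChart {ω : kˣ} (hω : IsPrimitiveRoot ω D.r) (s : Finset D.Ray)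
    (P : invariantRing (D.group ω)) :
    D.chartToLaurent s (D.invariantToChart hω s P) = toLaurent P.1 := by
  have h := (AlgEquiv.ofInjective (D.chartToLaurent (k := k) s)
    (D.chartToLaurent_injective s)).apply_symm_apply
    ⟨toLaurent P.1, D.toLaurent_mem_range hω s P⟩
  exact congrArg Subtype.val h

/-- The toric resolution `f : X ⟶ 𝔸² / G`, given on each chart by the inclusion of the ring of
invariants. -/
def resolution {ω : kˣ} (hω : IsPrimitiveRoot ω D.r) :
    D.toricSurface k ⟶ planeQuotient (D.group ω) :=
  colimit.desc (D.chartFunctor k)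
    { pt := planeQuotient (D.group ω)
      ι :=
        { app := fun s => Spec.map (CommRingCat.ofHom (D.invariantToChart hω s.1).toRingHom)
          naturality := by
            intro s t h
            change Spec.map _ ≫ Spec.map _ = Spec.map _ ≫ 𝟙 _
            rw [Category.comp_id, ← Spec.map_comp]
            congr 1
            refine CommRingCat.hom_ext (RingHom.ext fun P => D.chartToLaurent_injective s.1 ?_)
            change D.chartToLaurent s.1 (D.chartMap k (leOfHom h) (D.invariantToChart hω t.1 P)) =
              D.chartToLaurent s.1 (D.invariantToChart hω s.1 P)
            rw [chartToLaurent_chartMap, chartToLaurent_invariantToChart,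
              chartToLaurent_invariantToChart] } }

end CyclicQuotientType

section GIT

variable {k A Γ : Type*} [CommRing k] [CommRing A] [Algebra k A] [AddCommGroup Γ]
variable (𝒜 : Γ → Submodule k A) [SetLike.GradedMonoid 𝒜] (θ : Γ)

/-- The ring `⨁_{j ≥ 0} A_{jθ}` attached to a `Γ`-grading of a `k`-algebra `A` and `θ ∈ Γ`. The
summand `A_{jθ}` is placed in degree `j` by means of an auxiliary variable `T`: the ring consists
of the polynomials `∑ a_j T ^ j` with `a_j ∈ A_{jθ}`. -/
def semiInvariants : Subalgebra k (Polynomial A) where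
  carrier := {p | ∀ j : ℕ, p.coeff j ∈ 𝒜 (j • θ)}
  mul_mem' {p q} hp hq j := by
    rw [Polynomial.coeff_mul]
    refine Submodule.sum_mem _ fun x hx => ?_
    rw [← Finset.HasAntidiagonal.mem_antidiagonal.mp hx, add_smul]
    exact SetLike.mul_mem_graded (hp x.1) (hq x.2)
  add_mem' {p q} hp hq j := by
    rw [Polynomial.coeff_add]
    exact Submodule.add_mem _ (hp j) (hq j)
  algebraMap_mem' x j := by
    rw [Polynomial.algebraMap_apply, Polynomial.coeff_C]
    split_ifs with h
    · rw [h, zero_smul, Algebra.algebraMap_eq_smul_one]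
      exact Submodule.smul_mem _ _ (SetLike.GradedOne.one_mem)
    · exact Submodule.zero_mem _

/-- The summand `A_{jθ}` of `⨁_{j ≥ 0} A_{jθ}`. -/
def semiInvariantsGrading (j : ℕ) : Submodule k (semiInvariants 𝒜 θ) where
  carrier := {p | ∀ i : ℕ, i ≠ j → p.1.coeff i = 0}
  add_mem' {p q} hp hq i hi := by
    change (p.1 + q.1).coeff i = 0
    rw [Polynomial.coeff_add, hp i hi, hq i hi, add_zero]
  zero_mem' i _ := Polynomial.coeff_zero i
  smul_mem' x p hp i hi := by
    change (x • p.1).coeff i = 0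
    rw [Polynomial.coeff_smul, hp i hi, smul_zero]

instance semiInvariantsGrading_gradedMonoid :
    SetLike.GradedMonoid (semiInvariantsGrading 𝒜 θ) where
  one_mem i hi := by
    change (1 : Polynomial A).coeff i = 0
    rw [Polynomial.coeff_one, if_neg hi]
  mul_mem i j p q hp hq n hn := by
    change (p.1 * q.1).coeff n = 0
    rw [Polynomial.coeff_mul]
    refine Finset.sum_eq_zero fun x hx => ?_
    have hx2 := Finset.HasAntidiagonal.mem_antidiagonal.mp hx
    by_cases h : x.1 = i
    · rw [hq x.2 (fun h2 => hn (by rw [← hx2, h, h2])), mul_zero]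
    · rw [hp x.1 h, zero_mul]

/-- The homogeneous component of degree `j`. -/
def semiInvariantsComponent (j : ℕ) : semiInvariants 𝒜 θ →+ semiInvariantsGrading 𝒜 θ j where
  toFun p := ⟨⟨Polynomial.monomial j (p.1.coeff j), fun i => by
    rw [Polynomial.coeff_monomial]
    split_ifs with h
    · rw [← h]; exact p.2 j
    · exact Submodule.zero_mem _⟩, fun i hi => by
    change (Polynomial.monomial j (p.1.coeff j)).coeff i = 0
    rw [Polynomial.coeff_monomial, if_neg (Ne.symm hi)]⟩
  map_zero' := Subtype.ext (Subtype.ext (by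
    change Polynomial.monomial j ((0 : Polynomial A).coeff j) = 0
    rw [Polynomial.coeff_zero, map_zero]))
  map_add' p q := Subtype.ext (Subtype.ext (by
    change Polynomial.monomial j ((p.1 + q.1).coeff j) =
      Polynomial.monomial j (p.1.coeff j) + Polynomial.monomial j (q.1.coeff j)
    rw [Polynomial.coeff_add, map_add]))

lemma semiInvariantsComponent_of_mem {i : ℕ} (j : ℕ) (p : semiInvariantsGrading 𝒜 θ i) :
    semiInvariantsComponent 𝒜 θ j p.1 =
      (DirectSum.of (fun n => semiInvariantsGrading 𝒜 θ n) i p) j := by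
  by_cases h : i = j
  · subst h
    rw [DirectSum.of_eq_same]
    refine Subtype.ext (Subtype.ext (Polynomial.ext fun n => ?_))
    change (Polynomial.monomial i (p.1.1.coeff i)).coeff n = p.1.1.coeff n
    rw [Polynomial.coeff_monomial]
    split_ifs with h
    · exact congrArg p.1.1.coeff h
    · exact (p.2 n (Ne.symm h)).symm
  · rw [DirectSum.of_eq_of_ne _ _ _ (Ne.symm h)]
    refine Subtype.ext (Subtype.ext ?_)
    change Polynomial.monomial j (p.1.1.coeff j) = 0
    rw [p.2 j (Ne.symm h), map_zero]

instance semiInvariantsGrading_decomposition :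
    DirectSum.Decomposition (semiInvariantsGrading 𝒜 θ) where
  decompose' p := ∑ j ∈ p.1.support,
    DirectSum.of (fun n => semiInvariantsGrading 𝒜 θ n) j (semiInvariantsComponent 𝒜 θ j p)
  left_inv p := by
    rw [map_sum]
    refine Subtype.ext ?_
    rw [AddSubmonoidClass.coe_finsetSum]
    simp only [DirectSum.coeAddMonoidHom_of]
    exact p.1.as_sum_support.symm
  right_inv z := by
    refine DFinsupp.ext fun n => ?_
    have h1 : ∀ p : semiInvariants 𝒜 θ, (∑ j ∈ p.1.support,
        DirectSum.of (fun n => semiInvariantsGrading 𝒜 θ n) j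
          (semiInvariantsComponent 𝒜 θ j p)) n = semiInvariantsComponent 𝒜 θ n p := by
      intro p
      rw [DirectSum.sum_apply]
      by_cases hn : n ∈ p.1.support
      · rw [Finset.sum_eq_single n, DirectSum.of_eq_same]
        · intro j _ hj
          exact DirectSum.of_eq_of_ne _ _ _ (Ne.symm hj)
        · exact fun h => absurd hn h
      · rw [Finset.sum_eq_zero]
        · refine Subtype.ext (Subtype.ext ?_)
          change 0 = Polynomial.monomial n (p.1.coeff n)
          rw [Polynomial.notMem_support_iff.mp hn, map_zero]
        · intro j hj
          exact DirectSum.of_eq_of_ne _ _ _ (fun h => hn (h ▸ hj))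
    refine (h1 _).trans ?_
    induction z using DirectSum.induction_on with
    | zero => rw [map_zero, map_zero]; rfl
    | of i p => rw [DirectSum.coeAddMonoidHom_of, semiInvariantsComponent_of_mem]
    | add x y hx hy => rw [map_add, map_add, hx, hy]; rfl

instance semiInvariantsGrading_gradedAlgebra : GradedAlgebra (semiInvariantsGrading 𝒜 θ) where

/-- The affine quotient `Spec A_0` of `Spec A` by the torus `Hom(Γ, k^×)`. -/
def affineQuotient : Scheme := Spec (CommRingCat.of (𝒜 0))

/-- The GIT quotient `Proj (⨁_{j ≥ 0} A_{jθ})` of `Spec A` by the torus `Hom(Γ, k^×)`, linearised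
by the character `θ`. -/
def gitQuotient : Scheme := Proj (semiInvariantsGrading 𝒜 θ)

/-- The isomorphism of `A_0` with the degree zero summand of `⨁_{j ≥ 0} A_{jθ}`. -/
def toSemiInvariantsZero : 𝒜 0 →+* semiInvariantsGrading 𝒜 θ 0 where
  toFun x := ⟨⟨Polynomial.C x.1, fun j => by
    rw [Polynomial.coeff_C]
    split_ifs with h
    · rw [h, zero_smul]; exact x.2
    · exact Submodule.zero_mem _⟩, fun i hi => by
    change (Polynomial.C x.1).coeff i = 0
    rw [Polynomial.coeff_C, if_neg hi]⟩
  map_one' := Subtype.ext (Subtype.ext (map_one Polynomial.C))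
  map_zero' := Subtype.ext (Subtype.ext (map_zero Polynomial.C))
  map_add' x y := Subtype.ext (Subtype.ext (map_add Polynomial.C x.1 y.1))
  map_mul' x y := Subtype.ext (Subtype.ext (map_mul Polynomial.C x.1 y.1))

/-- The morphism `Spec A //_θ T ⟶ Spec A / T` obtained by varying the character from `θ` to `0`,
that is, the structure morphism `Proj (⨁_{j ≥ 0} A_{jθ}) ⟶ Spec A_0`. -/
def gitVariation : gitQuotient 𝒜 θ ⟶ affineQuotient 𝒜 :=
  Proj.toSpecZero (semiInvariantsGrading 𝒜 θ) ≫
    Spec.map (CommRingCat.ofHom (toSemiInvariantsZero 𝒜 θ))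

end GIT

attribute [local instance] MvPolynomial.gradedAlgebra

/-- Projective space of dimension `n` over an affine base. -/
def projectiveSpace (n : ℕ) (R : Type*) [CommRing R] : Scheme :=
  Proj (MvPolynomial.homogeneousSubmodule (Fin (n + 1)) R)

/-- The structure morphism of projective space. -/
def projectiveSpaceToBase (n : ℕ) (R : Type*) [CommRing R] :
    projectiveSpace n R ⟶ Spec (CommRingCat.of R) :=
  Proj.toSpecZero (MvPolynomial.homogeneousSubmodule (Fin (n + 1)) R) ≫
    Spec.map (CommRingCat.ofHom
      (algebraMap R (MvPolynomial.homogeneousSubmodule (Fin (n + 1)) R 0)))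

/-- A morphism to an affine scheme is projective if it factors as a closed immersion into a
projective space over the base followed by the structure morphism. -/
def IsProjectiveMorphism {X : Scheme} {R : Type*} [CommRing R]
    (f : X ⟶ Spec (CommRingCat.of R)) : Prop :=
  ∃ (n : ℕ) (i : X ⟶ projectiveSpace n R),
    IsClosedImmersion i ∧ i ≫ projectiveSpaceToBase n R = f

namespace CyclicQuotientType

variable (D : CyclicQuotientType)

/-- The group of principal torus-invariant divisors `∑ ⟨m, v_j⟩ D_j` with `m ∈ M`. -/
def principal : AddSubgroup (D.Ray → ℤ) where
  carrier := {d | ∃ m ∈ D.latticeM, ∀ ρ : D.Ray, (D.r : ℤ) * d ρ = D.pair ρ m}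
  zero_mem' := ⟨0, D.latticeM.zero_mem, by simp⟩
  add_mem' := by
    rintro d e ⟨m, hm, hd⟩ ⟨n, hn, he⟩
    exact ⟨m + n, D.latticeM.add_mem hm hn, fun ρ => by
      rw [map_add, ← hd, ← he, Pi.add_apply, mul_add]⟩
  neg_mem' := by
    rintro d ⟨m, hm, hd⟩
    exact ⟨-m, D.latticeM.neg_mem hm, fun ρ => by rw [map_neg, ← hd, Pi.neg_apply, mul_neg]⟩

/-- The Picard group of the toric surface: torus-invariant divisors modulo principal ones. -/
abbrev Pic : Type := (D.Ray → ℤ) ⧸ D.principal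

/-- The class `𝒪(d)` of a torus-invariant divisor. -/
def divisorClass : (D.Ray → ℤ) →+ D.Pic := QuotientAddGroup.mk' D.principal

/-- The degree of a line bundle on the exceptional curve `D_{j+1}` of the ray `v_{j+1}`
(`0 ≤ j < ℓ`), computed by the intersection numbers `D_{j+1} · D_j = D_{j+1} · D_{j+2} = 1` and
`D_{j+1} · D_{j+1} = -c_{j+1}`, all others being zero. -/
def degOn (j : Fin D.ℓ) : D.Pic →+ ℤ :=
  QuotientAddGroup.lift D.principal
    { toFun := fun d => d j.castSucc.castSucc - D.coef j * d j.succ.castSucc + d j.succ.succ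
      map_zero' := by simp
      map_add' := fun d e => by simp only [Pi.add_apply]; ring }
    (by
      rintro d ⟨m, -, hd⟩
      have hr : (D.r : ℤ) ≠ 0 := by exact_mod_cast D.r_pos.ne'
      refine mul_left_cancel₀ hr ?_
      have h0 := hd j.castSucc.castSucc
      have h1 := hd j.succ.castSucc
      have h2 := hd j.succ.succ
      simp only [pair_apply, Fin.val_castSucc, Fin.val_succ, scaledRay, Prod.fst_sub,
        Prod.snd_sub, Prod.smul_fst, Prod.smul_snd, smul_eq_mul] at h0 h1 h2
      change (D.r : ℤ) * (d j.castSucc.castSucc - D.coef j * d j.succ.castSucc + d j.succ.succ) = _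
      rw [mul_zero, mul_add, mul_sub, h0, mul_left_comm, h1, h2]
      ring)

/-- The monomial in `x`, `y` obtained from the monomial of exponent `d` in the total coordinate
ring by setting the variables of the exceptional curves equal to `1`; the variable of the ray
`(1, 0)` becomes `x` and that of the ray `(0, 1)` becomes `y`. -/
def planeMonomial (k : Type*) [Field k] (d : D.Ray → ℕ) : MvPolynomial (Fin 2) k :=
  MvPolynomial.X 0 ^ d (Fin.last _) * MvPolynomial.X 1 ^ d 0

section QuiverOfSections

variable {D} {n : ℕ} (E : Fin (n + 1) → D.Pic)

/-- The effective divisor `d` is the divisor of zeroes of a torus-invariant section (unique up to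
scalars) of `E_j ⊗ E_i⁻¹`. -/
def IsSectionDivisor (i j : Fin (n + 1)) (d : D.Ray → ℕ) : Prop :=
  D.divisorClass (fun ρ => (d ρ : ℤ)) = E j - E i

/-- A torus-invariant section of `E_j ⊗ E_i⁻¹`, given by its divisor, is irreducible if it is not
an isomorphism and is not the product of two torus-invariant sections `E_i → E_l` and
`E_l → E_j`, neither of which is an isomorphism. -/
def IsIrreducibleSection (i j : Fin (n + 1)) (d : D.Ray → ℕ) : Prop :=
  IsSectionDivisor E i j d ∧ d ≠ 0 ∧
    ∀ (l : Fin (n + 1)) (d₁ d₂ : D.Ray → ℕ), IsSectionDivisor E i l d₁ →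
      IsSectionDivisor E l j d₂ → d = d₁ + d₂ → d₁ = 0 ∨ d₂ = 0

/-- The arrows of the quiver of sections of `E`, whose vertices are `0, …, n`. -/
structure Arrow where
  /-- The tail. -/
  tail : Fin (n + 1)
  /-- The head. -/
  head : Fin (n + 1)
  /-- The labelling divisor. -/
  label : D.Ray → ℕ
  irreducible : IsIrreducibleSection E tail head label

/-- The image `χ_{h(a)} - χ_{t(a)}` of an arrow under the incidence map. -/
def Arrow.inc (b : Arrow E) : Fin (n + 1) → ℤ := Pi.single b.head 1 - Pi.single b.tail 1

/-- The image of `u ∈ ℕ^{Q₁}` under `π = (inc, div)`. -/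
def incDiv (u : Arrow E →₀ ℕ) : (Fin (n + 1) → ℤ) × (D.Ray → ℕ) :=
  (u.sum fun b e => e • b.inc, u.sum fun b e => e • b.label)

variable (k : Type*) [Field k]

/-- The toric ideal `I_Q` generated by the binomials `y^u - y^v` with `π(u) = π(v)`. -/
def toricIdeal : Ideal (MvPolynomial (Arrow E) k) :=
  Ideal.span {P | ∃ u v : Arrow E →₀ ℕ, incDiv E u = incDiv E v ∧
    P = MvPolynomial.monomial u 1 - MvPolynomial.monomial v 1}

/-- The coordinate ring `k[y_a : a ∈ Q₁] / I_Q` of `𝕍(I_Q)`. -/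
abbrev ToricRing : Type _ := MvPolynomial (Arrow E) k ⧸ toricIdeal E k

/-- The grading of the coordinate ring of `𝕍(I_Q)` by weights, induced by the grading of
`k[y_a : a ∈ Q₁]` for which `y_a` has degree `inc(a)`; it encodes the action of the torus `T_Q`. -/
def weightGrading (θ : Fin (n + 1) → ℤ) : Submodule k (ToricRing E k) :=
  (MvPolynomial.weightedHomogeneousSubmodule k (Arrow.inc E) θ).map
    (Ideal.Quotient.mkₐ k (toricIdeal E k)).toLinearMap

instance weightGrading_gradedMonoid : SetLike.GradedMonoid (weightGrading E k) where
  one_mem := ⟨1, MvPolynomial.isWeightedHomogeneous_one k _,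
    map_one (Ideal.Quotient.mkₐ k (toricIdeal E k))⟩
  mul_mem := by
    rintro θ η _ _ ⟨p, hp, rfl⟩ ⟨q, hq, rfl⟩
    exact ⟨p * q, MvPolynomial.IsWeightedHomogeneous.mul hp hq,
      map_mul (Ideal.Quotient.mkₐ k (toricIdeal E k)) p q⟩

/-- The weight `ϑ = (-n, 1, …, 1)`. -/
def specialWeight (n : ℕ) : Fin (n + 1) → ℤ := fun i => if i = 0 then -(n : ℤ) else 1

/-- The quotient `𝕍(I_Q) //_ϑ T_Q`. -/
abbrev toricGIT : Scheme := gitQuotient (weightGrading E k) (specialWeight n)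

/-- The affine quotient `𝕍(I_Q) / T_Q`. -/
abbrev toricAffine : Scheme := affineQuotient (weightGrading E k)

/-- The morphism `𝕍(I_Q) //_ϑ T_Q ⟶ 𝕍(I_Q) / T_Q` obtained by variation of GIT quotient. -/
abbrev toricVariation : toricGIT E k ⟶ toricAffine E k :=
  gitVariation (weightGrading E k) (specialWeight n)

end QuiverOfSections

end CyclicQuotientType

end

/-! A torus-invariant divisor on `X` is an integer sequence indexed by the rays, and its degree on
an exceptional curve is the twisted second difference `f j - c j * f (j + 1) + f (j + 2)`. Divisors
of degree zero obey the recursion of the rays, so they are exactly the divisors of characters in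
`M`. Hence line bundles are detected by their degrees, the divisor of a monomial in the arrows
determines its weight, and `I_Q` is the kernel of `y_b ↦ x ^ div(b)`. Thus `A` embeds in the Laurent
polynomials in the Cox variables (`IsDualCollection.coxMap_injective`).

Two convexity arguments, both resting on `c j ≥ 2`, describe the image. An effective divisor of
nonnegative degrees, with positive degree on one curve, dominates an effective divisor of degree one
on that curve and zero on the others (`exists_unit_le`). Splitting off such pieces shows that the
monomials in the arrows have as divisors all effective divisors of nonnegative degrees. In
particular the piece of weight `n • ϑ` is the space of sections of the `n`-th power of `L_1 ⊗ ⋯ ⊗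
L_ℓ`. Secondly, each effective divisor with all degrees `n + 1` dominates one of `ℓ + 1` vertex
divisors, each vanishing exactly on the two rays of a maximal cone (`exists_vertex_le`). So the
section ring is generated over `A_0` by finitely many elements of degree one, which gives
projectivity, and the basic opens of the vertex sections cover `Proj`.

For every cone there is a section vanishing exactly along the divisors of the rays outside it. The
degree-zero localisation at this section is `k[M ∩ σ^∨]`, since a quotient of two sections of the
same bundle is a character and poles outside the cone can be cleared. These charts glue as the fan
prescribes, whence `X ≅ Proj` (`IsDualCollection.isIso_toGIT`). In weight zero the effective
divisors are the characters in the quadrant, that is, the invariant monomials. Compatibility with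
`f` is checked chart by chart inside the Laurent polynomials in `x` and `y`. -/

noncomputable section

attribute [local instance] MvPolynomial.gradedAlgebra

/-! ### Linear recursions with prescribed twisted differences. -/

/-- The expression `f j - c j * f (j + 1) + f (j + 2)`, a degree-like second difference of the
sequence `f` with coefficients `c`. -/
def twistedDiff (c f : ℕ → ℤ) (j : ℕ) : ℤ := f j - c j * f (j + 1) + f (j + 2)

lemma twistedDiff_sub (c f g : ℕ → ℤ) (j : ℕ) :
    twistedDiff c (fun i => f i - g i) j = twistedDiff c f j - twistedDiff c g j := by
  simp only [twistedDiff]; ring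

lemma twistedDiff_neg (c f : ℕ → ℤ) (j : ℕ) :
    twistedDiff c (fun i => -f i) j = -twistedDiff c f j := by
  simp only [twistedDiff]; ring

/-- The sequence with prescribed twisted differences `n` and prescribed first two values. -/
def twistedSeq (c n : ℕ → ℤ) (a b : ℤ) : ℕ → ℤ
  | 0 => a
  | 1 => b
  | (j + 2) => n j + c j * twistedSeq c n a b (j + 1) - twistedSeq c n a b j

lemma twistedDiff_twistedSeq (c n : ℕ → ℤ) (a b : ℤ) (j : ℕ) :
    twistedDiff c (twistedSeq c n a b) j = n j := by
  simp only [twistedDiff, twistedSeq]; ring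

/-- Sequences with prescribed twisted differences and prescribed values at two consecutive
places exist. -/
lemma exists_twistedDiff_eq (c n : ℕ → ℤ) (i : ℕ) (a b : ℤ) :
    ∃ f : ℕ → ℤ, f i = a ∧ f (i + 1) = b ∧ ∀ j, twistedDiff c f j = n j := by
  let P := twistedSeq c n 0 0
  let U := twistedSeq c 0 0 1
  let V := twistedSeq c 0 1 0
  -- The discrete Wronskian of two solutions of the homogeneous recursion is constant, so initial
  -- values at `i` and `i + 1` can be solved for over the integers.
  have hdet : ∀ j, V j * U (j + 1) - V (j + 1) * U j = 1 := by
    intro j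
    induction j with
    | zero => simp [U, V, twistedSeq]
    | succ j ih =>
      have hU := twistedDiff_twistedSeq c 0 0 1 j
      have hV := twistedDiff_twistedSeq c 0 1 0 j
      simp only [twistedDiff, Pi.zero_apply] at hU hV
      change U j - c j * U (j + 1) + U (j + 2) = 0 at hU
      change V j - c j * V (j + 1) + V (j + 2) = 0 at hV
      linear_combination ih + V (j + 1) * hU - U (j + 1) * hV
  -- Cramer's rule: the particular solution `P` corrected by the two homogeneous solutions that take
  -- the values `1, 0` and `0, 1` at `i` and `i + 1`.
  refine ⟨fun j => P j + (a - P i) * (V j * U (i + 1) - V (i + 1) * U j)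
    + (b - P (i + 1)) * (V i * U j - V j * U i), ?_, ?_, fun j => ?_⟩
  · linear_combination (a - P i) * hdet i
  · linear_combination (b - P (i + 1)) * hdet i
  · have hP := twistedDiff_twistedSeq c n 0 0 j
    have hU := twistedDiff_twistedSeq c 0 0 1 j
    have hV := twistedDiff_twistedSeq c 0 1 0 j
    simp only [twistedDiff, Pi.zero_apply] at hP hU hV ⊢
    linear_combination hP + (a - P i) * (U (i + 1) * hV - V (i + 1) * hU)
      + (b - P (i + 1)) * (V i * hU - U i * hV)

/-! ### Convexity of sequences with nonnegative twisted differences. -/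

section Convexity

variable {c f : ℕ → ℤ} {N : ℕ}

/-- To the right of an ascent, a sequence with nonnegative twisted differences is increasing. -/
lemma nonneg_and_le_of_ascent (hc : ∀ j < N, 2 ≤ c j) {i : ℕ}
    (hf : ∀ j, i ≤ j → j < N → 0 ≤ twistedDiff c f j) (h0 : 0 ≤ f i) (h1 : f i ≤ f (i + 1))
    (j : ℕ) (hij : i ≤ j) (hj : j ≤ N) : 0 ≤ f j ∧ f j ≤ f (j + 1) := by
  induction j, hij using Nat.le_induction with
  | base => exact ⟨h0, h1⟩
  | succ j hij ih =>
    obtain ⟨a, b⟩ := ih (by omega)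
    -- The ascent propagates: `f (j + 2) ≥ c j * f (j + 1) - f j ≥ 2 * f (j + 1) - f j ≥ f (j + 1)`.
    have h2 := hf j hij hj
    have h3 := hc j hj
    simp only [twistedDiff] at h2
    exact ⟨a.trans b, by nlinarith⟩

/-- To the left of a descent, a sequence with nonnegative twisted differences is decreasing. -/
lemma nonneg_and_le_of_descent (hc : ∀ j < N, 2 ≤ c j) {i : ℕ} (hi : i ≤ N)
    (hf : ∀ j < i, 0 ≤ twistedDiff c f j) (h0 : 0 ≤ f (i + 1)) (h1 : f (i + 1) ≤ f i)
    (j : ℕ) (hj : j ≤ i) : 0 ≤ f (j + 1) ∧ f (j + 1) ≤ f j := by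
  induction hj using Nat.decreasingInduction with
  | self => exact ⟨h0, h1⟩
  | of_succ j hij ih =>
    obtain ⟨a, b⟩ := ih
    have h2 := hf j hij
    have h3 := hc j (by omega)
    simp only [twistedDiff] at h2
    exact ⟨a.trans b, by nlinarith⟩

lemma nonneg_right (hc : ∀ j < N, 2 ≤ c j) {i : ℕ}
    (hf : ∀ j, i ≤ j → j < N → 0 ≤ twistedDiff c f j) (h0 : 0 ≤ f i) (h1 : f i ≤ f (i + 1))
    (j : ℕ) (hij : i ≤ j) (hj : j ≤ N + 1) : 0 ≤ f j := by
  rcases Nat.eq_or_lt_of_le hj with rfl | h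
  · rcases Nat.eq_or_lt_of_le hij with rfl | h
    · exact h0
    · have := nonneg_and_le_of_ascent hc hf h0 h1 N (by omega) le_rfl
      exact this.1.trans this.2
  · exact (nonneg_and_le_of_ascent hc hf h0 h1 j hij (by omega)).1

lemma nonneg_left (hc : ∀ j < N, 2 ≤ c j) {i : ℕ} (hi : i ≤ N)
    (hf : ∀ j < i, 0 ≤ twistedDiff c f j) (h0 : 0 ≤ f (i + 1)) (h1 : f (i + 1) ≤ f i)
    (j : ℕ) (hj : j ≤ i + 1) : 0 ≤ f j := by
  cases j with
  | zero =>
    have := nonneg_and_le_of_descent hc hi hf h0 h1 0 (by omega)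
    exact this.1.trans this.2
  | succ j => exact (nonneg_and_le_of_descent hc hi hf h0 h1 j (by omega)).1

/-- Two consecutive zeros count as an ascent both for `f` and for `-f`, so nonnegativity applies to
each. -/
lemma eq_zero_right (hc : ∀ j < N, 2 ≤ c j) {i : ℕ}
    (hf : ∀ j, i ≤ j → j < N → twistedDiff c f j = 0) (h0 : f i = 0) (h1 : f (i + 1) = 0)
    (j : ℕ) (hij : i ≤ j) (hj : j ≤ N + 1) : f j = 0 := by
  refine le_antisymm ?_ (nonneg_right hc (fun j h h' => (hf j h h').ge) (by omega) (by omega)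
    j hij hj)
  have := nonneg_right (f := fun i => -f i) hc
    (fun j h h' => by rw [twistedDiff_neg, hf j h h', neg_zero]) (by omega) (by omega) j hij hj
  omega

lemma eq_zero_left (hc : ∀ j < N, 2 ≤ c j) {i : ℕ} (hi : i ≤ N)
    (hf : ∀ j < i, twistedDiff c f j = 0) (h0 : f i = 0) (h1 : f (i + 1) = 0)
    (j : ℕ) (hj : j ≤ i + 1) : f j = 0 := by
  refine le_antisymm ?_ (nonneg_left hc hi (fun j h => (hf j h).ge) (by omega) (by omega) j hj)
  have := nonneg_left (f := fun i => -f i) hc hi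
    (fun j h => by rw [twistedDiff_neg, hf j h, neg_zero]) (by omega) (by omega) j hj
  omega

/-- A nonnegative sequence with nonnegative twisted differences, positive at `l`, dominates a
nonnegative sequence whose twisted differences are `1` at `l` and `0` elsewhere. -/
lemma exists_unit_le (hc : ∀ j < N, 2 ≤ c j) (h0 : ∀ j ≤ N + 1, 0 ≤ f j)
    (hf : ∀ j < N, 0 ≤ twistedDiff c f j) {l : ℕ} (hl : l < N) (hfl : 1 ≤ twistedDiff c f l) :
    ∃ g : ℕ → ℤ, (∀ j, twistedDiff c g j = if l = j then 1 else 0) ∧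
      ∀ j ≤ N + 1, 0 ≤ g j ∧ g j ≤ f j := by
  have hcl := hc l hl
  have e1 := h0 (l + 1) (by omega)
  -- If `f` rises strictly after `l + 1`, take `g` zero up to `l + 1` with `g (l + 2) = 1`; then `f
  -- - g` still ascends at `l + 1`. Otherwise the mirror image is used: `g l = 1`, and `g` is zero
  -- from `l + 1` on.
  by_cases h : f (l + 1) + 1 ≤ f (l + 2)
  · obtain ⟨g, g0, g1, hg⟩ := exists_twistedDiff_eq c (fun j => if l = j then 1 else 0) (l + 1) 0 1
    have gl := hg l
    simp only [twistedDiff, g0, g1, if_true] at gl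
    have gz : ∀ j ≤ l + 1, g j = 0 := eq_zero_left hc hl.le
      (fun j hj => by rw [hg, if_neg (by omega)]) (by linarith) g0
    refine ⟨g, hg, fun j hj => ?_⟩
    rcases le_total j (l + 1) with hjl | hjl
    · rw [gz j hjl]
      exact ⟨le_rfl, h0 j hj⟩
    · have a := nonneg_right hc (f := g) (i := l + 1)
        (fun j _ _ => by rw [hg]; split_ifs <;> norm_num) g0.ge (by rw [g0, g1]; norm_num) j hjl hj
      have b := nonneg_right hc (f := fun i => f i - g i) (i := l + 1)
        (fun j hj hN => by rw [twistedDiff_sub, hg, if_neg (by omega), sub_zero]; exact hf j hN)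
        (by rw [g0]; omega) (by rw [g0, show l + 1 + 1 = l + 2 from rfl, g1]; omega) j hjl hj
      exact ⟨a, by omega⟩
  · obtain ⟨g, g0, g1, hg⟩ := exists_twistedDiff_eq c (fun j => if l = j then 1 else 0) l 1 0
    have gl := hg l
    simp only [twistedDiff, g0, g1, if_true] at gl hfl
    -- Without a rise, `f l ≥ 1 + c l * f (l + 1) - f (l + 2) ≥ 1 + f (l + 1)`, so `f` drops
    -- strictly from `l` to `l + 1`.
    have fl : f (l + 1) + 1 ≤ f l := by nlinarith
    have gz : ∀ j, l + 1 ≤ j → j ≤ N + 1 → g j = 0 := eq_zero_right hc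
      (fun j hj _ => by rw [hg, if_neg (by omega)]) g1 (by linarith)
    refine ⟨g, hg, fun j hj => ?_⟩
    rcases le_total (l + 1) j with hjl | hjl
    · rw [gz j hjl hj]
      exact ⟨le_rfl, h0 j hj⟩
    · have a := nonneg_left hc (f := g) hl.le
        (fun j _ => by rw [hg]; split_ifs <;> norm_num) g1.ge (by rw [g0, g1]; norm_num) j hjl
      have b := nonneg_left hc (f := fun i => f i - g i) hl.le
        (fun j hj => by
          rw [twistedDiff_sub, hg, if_neg (by omega), sub_zero]; exact hf j (by omega))
        (by rw [g1]; omega) (by rw [g0, g1]; omega) j hjl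
      exact ⟨a, by omega⟩

/-- A sequence all of whose twisted differences are `1` and which vanishes at `i` and `i + 1` is
positive elsewhere. -/
lemma pos_of_twistedDiff_eq_one (hc : ∀ j < N, 2 ≤ c j) {i : ℕ} (hi : i ≤ N)
    (hf : ∀ j, twistedDiff c f j = 1) (h0 : f i = 0) (h1 : f (i + 1) = 0) (j : ℕ) (hj : j ≤ N + 1)
    (hji : j ≠ i) (hji' : j ≠ i + 1) : 0 < f j := by
  rcases lt_or_gt_of_ne hji with h | h
  · obtain ⟨i, rfl⟩ : ∃ i', i = i' + 1 := ⟨i - 1, by omega⟩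
    -- Next to the pair of zeros the recursion gives the value `1`; from there monotonicity keeps
    -- the sequence positive.
    have h2 := hf i
    simp only [twistedDiff, h0, show i + 2 = i + 1 + 1 from rfl, h1] at h2
    have h3 := nonneg_and_le_of_descent hc (i := i) (by omega) (fun j _ => by rw [hf]; norm_num)
      h0.ge (by linarith)
    have h4 : j ≤ i := by omega
    induction h4 using Nat.decreasingInduction with
    | self => linarith
    | of_succ j hij ih =>
      exact (ih (by omega) (by omega) (by omega) (by omega)).trans_le (h3 j (by omega)).2
  · have h2 := hf i
    simp only [twistedDiff, h0, h1] at h2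
    have h3 := nonneg_and_le_of_ascent hc (i := i + 1) (fun j _ _ => by rw [hf]; norm_num)
      h1.ge (by rw [show i + 1 + 1 = i + 2 from rfl]; linarith)
    have h4 : i + 2 ≤ j := by omega
    induction j, h4 using Nat.le_induction with
    | base => linarith
    | succ j hij ih =>
      exact (ih (by omega) (by omega) (by omega) (by omega)).trans_le (h3 j (by omega) (by omega)).2

/-- A nonnegative sequence with constant positive twisted differences dominates one of the
sequences with twisted differences `1` that vanish at two consecutive places. -/
lemma exists_vertex_le (hc : ∀ j < N, 2 ≤ c j) (h0 : ∀ j ≤ N + 1, 0 ≤ f j)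
    (hf : ∀ j < N, 1 ≤ twistedDiff c f j) :
    ∃ i ≤ N, ∀ g : ℕ → ℤ, g i = 0 → g (i + 1) = 0 → (∀ j, twistedDiff c g j = 1) →
      ∀ j ≤ N + 1, g j ≤ f j := by
  classical
  -- The zeros of `g` go where `f` stops descending: the least `i` with a strict rise after `i + 1`,
  -- or `N` if there is none. As `g (i + 2) = 1`, such a rise makes `f - g` ascend at `i + 1`.
  have hex : ∃ i, i = N ∨ f (i + 1) + 1 ≤ f (i + 2) := ⟨N, Or.inl rfl⟩
  let i := Nat.find hex
  have hi := Nat.find_spec hex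
  have hiN : i ≤ N := Nat.find_min' hex (Or.inl rfl)
  refine ⟨i, hiN, fun g g0 g1 hg j hj => ?_⟩
  have hd : ∀ j < N, 0 ≤ twistedDiff c (fun k => f k - g k) j := fun j hj => by
    rw [twistedDiff_sub, hg]
    linarith [hf j hj]
  suffices h : 0 ≤ f j - g j by linarith
  have hgi := hg i
  simp only [twistedDiff, g0, g1] at hgi
  rcases le_total (i + 1) j with h | h
  · rcases hi with hi | hi
    · obtain rfl : j = i + 1 := by
        have : i = N := hi
        omega
      rw [g1]
      linarith [h0 (i + 1) (by omega)]
    · refine nonneg_right hc (f := fun k => f k - g k) (i := i + 1) (fun j _ => hd j) ?_ ?_ _ h hj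
      · rw [g1]; linarith [h0 (i + 1) (by omega)]
      · change f (i + 1) - g (i + 1) ≤ f (i + 2) - g (i + 2)
        change f (i + 1) + 1 ≤ f (i + 2) at hi
        linarith
  · rcases Nat.eq_or_lt_of_le h with rfl | hji
    · rw [g1]; linarith [h0 (i + 1) hj]
    obtain hz | ⟨k, hk⟩ : i = 0 ∨ ∃ k, i = k + 1 := by
      cases i with
      | zero => exact Or.inl rfl
      | succ k => exact Or.inr ⟨k, rfl⟩
    · obtain rfl : j = i := by omega
      rw [g0]; linarith [h0 i hj]
    · have hmin := Nat.find_min hex (m := k) (by change k < i; omega)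
      push Not at hmin
      have hfk := hf k (by omega)
      have hgk := hg k
      have hck := hc k (by omega)
      have e0 := h0 (k + 1) (by omega)
      rw [hk] at g0 g1
      simp only [twistedDiff, g0, show k + 2 = k + 1 + 1 from rfl, g1] at hgk hfk hmin
      refine nonneg_left hc (f := fun k => f k - g k) (i := k) (by omega)
        (fun j hj => hd j (by omega)) ?_ ?_ j (by omega)
      · rw [g0]; linarith
      · rw [g0]; nlinarith [hmin.2]

end Convexity

/-! ### Divisors, degrees and characters on the toric surface. -/

namespace CyclicQuotientType

variable (D : CyclicQuotientType)

lemma two_le_coef : ∀ j < D.ℓ, 2 ≤ D.coef j := fun j hj => by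
  rw [D.coef_eq j hj]
  exact_mod_cast D.two_le _ (List.getElem_mem _)

/-- The degrees of a divisor on the exceptional curves. -/
def divDeg : (D.Ray → ℤ) →+ (Fin D.ℓ → ℤ) where
  toFun d j := D.degOn j (D.divisorClass d)
  map_zero' := by ext; simp
  map_add' d e := by ext; simp

/-- The bridge from intersection numbers to the sequences studied above. -/
lemma divDeg_restrict (f : ℕ → ℤ) (j : Fin D.ℓ) :
    D.divDeg (fun ρ => f ρ) j = twistedDiff D.coef f j := rfl

/-- Extension by zero is harmless: the degrees on the exceptional curves only involve indices up to
`ℓ + 1`. -/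
lemma exists_restrict (d : D.Ray → ℤ) : ∃ f : ℕ → ℤ, d = fun ρ : D.Ray => f ρ :=
  ⟨fun j => if h : j < D.ℓ + 2 then d ⟨j, h⟩ else 0, by ext ρ; simp⟩

/-- With `v = scaledRay j`, the pairing is `m.2 * (v.2 - a * v.1) + v.1 * (m.1 + a * m.2)`, and both
brackets are divisible by `r`. This makes the division in `charDiv` exact. -/
lemma dvd_pair (j : ℕ) {m : ℤ × ℤ} (hm : m ∈ D.latticeM) : (D.r : ℤ) ∣ D.pair j m := by
  have h1 := (D.scaledRay_dvd j).mul_left m.2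
  have h2 : (D.r : ℤ) ∣ (D.scaledRay j).1 * (m.1 + D.a * m.2) := Dvd.dvd.mul_left hm _
  refine (dvd_add h1 h2).trans (dvd_of_eq ?_)
  rw [pair_apply]
  ring

/-- The divisor of the character of exponent `m`. -/
def charDiv (m : D.latticeM) : D.Ray → ℤ := fun ρ => D.pair ρ m / D.r

lemma r_mul_charDiv (m : D.latticeM) (ρ : D.Ray) : (D.r : ℤ) * D.charDiv m ρ = D.pair ρ m :=
  Int.mul_ediv_cancel' (D.dvd_pair ρ m.2)

lemma r_ne_zero : (D.r : ℤ) ≠ 0 := by exact_mod_cast D.r_pos.ne'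

/-- The homomorphism sending a character to its divisor. -/
def charDivHom : D.latticeM →+ (D.Ray → ℤ) where
  toFun := D.charDiv
  map_zero' := by
    ext ρ
    refine mul_left_cancel₀ D.r_ne_zero ?_
    rw [r_mul_charDiv]
    simp
  map_add' m n := by
    ext ρ
    refine mul_left_cancel₀ D.r_ne_zero ?_
    rw [r_mul_charDiv, Pi.add_apply, mul_add, r_mul_charDiv, r_mul_charDiv]
    simp

lemma r_mul_charDivHom (m : D.latticeM) (ρ : D.Ray) :
    (D.r : ℤ) * D.charDivHom m ρ = D.pair ρ m := D.r_mul_charDiv m ρ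

lemma charDivHom_nonneg_iff (m : D.latticeM) (ρ : D.Ray) :
    0 ≤ D.charDivHom m ρ ↔ 0 ≤ D.pair ρ m := by
  rw [← r_mul_charDivHom]
  exact (mul_nonneg_iff_of_pos_left (by exact_mod_cast D.r_pos)).symm

lemma charDivHom_zero_ray (m : D.latticeM) : D.charDivHom m 0 = m.1.2 := by
  refine mul_left_cancel₀ D.r_ne_zero ?_
  rw [r_mul_charDivHom, pair_apply]
  simp [scaledRay, mul_comm]

/-- As the last second coordinate vanishes, the determinant identity says that the last first
coordinate times the preceding second coordinate is `r`. The latter is `1`: the recursion is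
Euclid's algorithm for `r` and `a`. -/
lemma scaledRay_last_fst : (D.scaledRay (D.ℓ + 1)).1 = D.r := by
  have h1 := D.scaledRay_det D.ℓ
  have h2 := D.scaledRay_det 0
  have hlast := D.scaledRay_last_snd
  have hl : 0 < D.ℓ := List.length_pos_of_ne_nil D.c_ne_nil
  rw [hlast, zero_mul, sub_zero] at h1
  -- the second coordinate of the last but one vector is `gcd (a, r) = 1`
  have hgcd : ∀ j, ∀ x : ℤ, x ∣ (D.scaledRay j).2 → x ∣ (D.scaledRay (j + 1)).2 → x ∣ 1 := by
    intro j
    induction j with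
    | zero =>
      intro x hx hx'
      have : IsCoprime (D.a : ℤ) (D.r : ℤ) := Nat.isCoprime_iff_coprime.mpr D.coprime
      exact (isUnit_iff_dvd_one.mp (this.isUnit_of_dvd' hx' hx))
    | succ j ih =>
      intro x hx hx'
      refine ih x ?_ hx
      have e : (D.scaledRay j).2 =
          D.coef j * (D.scaledRay (j + 1)).2 - (D.scaledRay (j + 2)).2 := by
        simp [scaledRay]
      rw [e]
      exact dvd_sub (hx.mul_left _) hx'
  have h3 := hgcd D.ℓ (D.scaledRay D.ℓ).2 dvd_rfl (by rw [hlast]; exact dvd_zero _)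
  have h4 := D.scaledRay_snd_nonneg D.ℓ (by omega)
  have h5 : (D.scaledRay D.ℓ).2 = 1 := Int.eq_one_of_dvd_one h4 h3
  rwa [h5, mul_one] at h1

lemma charDivHom_last (m : D.latticeM) : D.charDivHom m (Fin.last _) = m.1.1 := by
  refine mul_left_cancel₀ D.r_ne_zero ?_
  rw [r_mul_charDivHom, pair_apply, Fin.val_last, scaledRay_last_fst, scaledRay_last_snd]
  ring

lemma charDivHom_injective : Function.Injective D.charDivHom := by
  intro m n h
  refine Subtype.ext (Prod.ext ?_ ?_)
  · rw [← charDivHom_last, ← charDivHom_last, h]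
  · rw [← charDivHom_zero_ray, ← charDivHom_zero_ray, h]

lemma charDivHom_mem_principal (m : D.latticeM) : D.charDivHom m ∈ D.principal :=
  ⟨m.1, m.2, D.r_mul_charDivHom m⟩

lemma divDeg_charDivHom (m : D.latticeM) : D.divDeg (D.charDivHom m) = 0 := by
  ext j
  have h : D.divisorClass (D.charDivHom m) = 0 :=
    (QuotientAddGroup.eq_zero_iff _).mpr (D.charDivHom_mem_principal m)
  change D.degOn j (D.divisorClass _) = 0
  rw [h, map_zero]

/-- A divisor of degree zero satisfies the recursion of the rays, so it is the restriction of the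
linear function with the same values at `v_0` and `v_1`. -/
lemma exists_charDivHom_of_divDeg_eq_zero {d : D.Ray → ℤ} (hd : D.divDeg d = 0) :
    ∃ m : D.latticeM, D.charDivHom m = d := by
  obtain ⟨f, rfl⟩ := D.exists_restrict d
  -- Solves `⟨m, v_0⟩ = f 0` and `⟨m, v_1⟩ = f 1`.
  let m : D.latticeM := ⟨(D.r * f 1 - D.a * f 0, f 0), by
    change (D.r : ℤ) ∣ D.r * f 1 - D.a * f 0 + D.a * f 0
    simp⟩
  have key : ∀ j ≤ D.ℓ, D.pair j m.1 = D.r * f j ∧ D.pair (j + 1) m.1 = D.r * f (j + 1) := by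
    intro j hj
    induction j with
    | zero =>
      simp only [pair_apply, scaledRay, m]
      constructor <;> ring
    | succ j ih =>
      obtain ⟨h0, h1⟩ := ih (by omega)
      refine ⟨h1, ?_⟩
      have h2 := congrFun hd ⟨j, hj⟩
      rw [divDeg_restrict, Pi.zero_apply] at h2
      simp only [twistedDiff] at h2
      simp only [pair_apply, scaledRay, Prod.fst_sub, Prod.snd_sub, Prod.smul_fst, Prod.smul_snd,
        smul_eq_mul] at h0 h1 ⊢
      linear_combination D.coef j * h1 - h0 - D.r * h2
  refine ⟨m, funext fun ρ => mul_left_cancel₀ D.r_ne_zero ?_⟩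
  rw [r_mul_charDivHom]
  rcases Nat.lt_or_ge ρ (D.ℓ + 1) with h | h
  · exact (key ρ (by omega)).1
  · have : (ρ : ℕ) = D.ℓ + 1 := by omega
    rw [this]
    exact (key D.ℓ le_rfl).2

lemma eq_zero_of_degOn_eq_zero {x : D.Pic} (hx : ∀ j, D.degOn j x = 0) : x = 0 := by
  obtain ⟨d, rfl⟩ := QuotientAddGroup.mk'_surjective _ x
  obtain ⟨m, rfl⟩ := D.exists_charDivHom_of_divDeg_eq_zero (d := d) (funext hx)
  exact (QuotientAddGroup.eq_zero_iff _).mpr (D.charDivHom_mem_principal m)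

/-- The weight of the torus `T_Q` by which the section of divisor `d` is scaled. -/
def weightOf : (D.Ray → ℤ) →+ (Fin (D.ℓ + 1) → ℤ) where
  toFun d := Fin.cons (-∑ j, D.divDeg d j) (D.divDeg d)
  map_zero' := by
    ext i
    refine Fin.cases ?_ (fun j => ?_) i <;> simp
  map_add' d e := by
    ext i
    refine Fin.cases ?_ (fun j => ?_) i
    · simp [Finset.sum_add_distrib, add_comm]
    · simp

/-- Both vectors have coordinate sum zero, so the coordinate at vertex `0` follows from the others.
-/
lemma weightOf_eq_iff {d : D.Ray → ℤ} {θ : Fin (D.ℓ + 1) → ℤ} (hθ : ∑ i, θ i = 0) :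
    D.weightOf d = θ ↔ ∀ j : Fin D.ℓ, D.divDeg d j = θ j.succ := by
  refine ⟨fun h j => by rw [← h]; rfl, fun h => ?_⟩
  ext i
  refine Fin.cases ?_ (fun j => h j) i
  rw [Fin.sum_univ_succ] at hθ
  change -∑ j, D.divDeg d j = _
  rw [Finset.sum_congr rfl fun j _ => h j]
  linarith

/-- The divisors of the torus-invariant sections of the `n`-th power of the line bundle of degree
one on all exceptional curves. -/
def sectionDivisors (n : ℕ) : Set (D.Ray → ℤ) := {d | 0 ≤ d ∧ ∀ j, D.divDeg d j = n}

variable {D}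

lemma add_mem_sectionDivisors {m n : ℕ} {d e : D.Ray → ℤ} (hd : d ∈ D.sectionDivisors m)
    (he : e ∈ D.sectionDivisors n) : d + e ∈ D.sectionDivisors (m + n) :=
  ⟨add_nonneg hd.1 he.1, fun j => by rw [map_add, Pi.add_apply, hd.2, he.2]; push_cast; rfl⟩

lemma nsmul_mem_sectionDivisors {m : ℕ} {d : D.Ray → ℤ} (hd : d ∈ D.sectionDivisors m) (n : ℕ) :
    n • d ∈ D.sectionDivisors (n * m) :=
  ⟨nsmul_nonneg hd.1 n, fun j => by rw [map_nsmul, Pi.smul_apply, hd.2]; simp⟩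

lemma weightOf_eq_smul_specialWeight_iff {d : D.Ray → ℤ} {n : ℕ} :
    D.weightOf d = n • specialWeight D.ℓ ↔ ∀ j, D.divDeg d j = n := by
  rw [weightOf_eq_iff]
  · simp [specialWeight]
  · rw [Fin.sum_univ_succ]
    simp [specialWeight, mul_comm]

variable (D) in
/-- The section that does not vanish at the fixed point of the `i`-th maximal cone, and vanishes
along all other invariant divisors. -/
lemma exists_vertexDivisor (i : Fin (D.ℓ + 1)) :
    ∃ d ∈ D.sectionDivisors 1, (∀ ρ, d ρ = 0 ↔ ρ ∈ ({i.castSucc, i.succ} : Finset D.Ray)) ∧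
      ∃ f : ℕ → ℤ, d = (fun ρ : D.Ray => f ρ) ∧ f i = 0 ∧ f (i + 1) = 0 ∧
        ∀ j, twistedDiff D.coef f j = 1 := by
  obtain ⟨f, f0, f1, hf⟩ := exists_twistedDiff_eq D.coef (fun _ => 1) i 0 0
  have hpos := fun j => pos_of_twistedDiff_eq_one D.two_le_coef (i := i) (by omega) hf f0 f1 j
  have key : ∀ ρ : D.Ray, (f ρ = 0 ↔ ρ ∈ ({i.castSucc, i.succ} : Finset D.Ray)) := by
    intro ρ
    have hρ : ρ ∈ ({i.castSucc, i.succ} : Finset D.Ray) ↔ (ρ : ℕ) = i ∨ (ρ : ℕ) = i + 1 := by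
      simp [Fin.ext_iff]
    rw [hρ]
    refine ⟨fun h => ?_, fun h => by rcases h with h | h <;> rw [h] <;> assumption⟩
    by_contra! h2
    exact (hpos ρ (by omega) h2.1 h2.2).ne' h
  refine ⟨fun ρ => f ρ, ⟨fun ρ => ?_, fun j => by rw [divDeg_restrict, hf]; rfl⟩, key,
    f, rfl, f0, f1, hf⟩
  by_cases h1 : (ρ : ℕ) = i
  · exact (by rw [h1, f0] : f ρ = 0).ge
  by_cases h2 : (ρ : ℕ) = i + 1
  · exact (by rw [h2, f1] : f ρ = 0).ge
  · exact (hpos ρ (by omega) h1 h2).le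

variable (D) in
/-- The divisor of the section that is nonzero exactly on the `i`-th maximal chart. -/
def vertexDivisor (i : Fin (D.ℓ + 1)) : D.Ray → ℤ := (D.exists_vertexDivisor i).choose

lemma vertexDivisor_mem (i : Fin (D.ℓ + 1)) : D.vertexDivisor i ∈ D.sectionDivisors 1 :=
  (D.exists_vertexDivisor i).choose_spec.1

lemma vertexDivisor_eq_zero_iff (i : Fin (D.ℓ + 1)) (ρ : D.Ray) :
    D.vertexDivisor i ρ = 0 ↔ ρ ∈ ({i.castSucc, i.succ} : Finset D.Ray) :=
  (D.exists_vertexDivisor i).choose_spec.2.1 ρ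

/-- The divisor form of generation in degree one: every monomial section of positive degree is
divisible by a vertex section. -/
lemma exists_sub_vertexDivisor_mem {n : ℕ} {d : D.Ray → ℤ} (hd : d ∈ D.sectionDivisors (n + 1)) :
    ∃ i, d - D.vertexDivisor i ∈ D.sectionDivisors n := by
  obtain ⟨f, rfl⟩ := D.exists_restrict d
  obtain ⟨i, hi, h⟩ := exists_vertex_le (f := f) D.two_le_coef
    (fun j hj => hd.1 ⟨j, by omega⟩) (fun j hj => by
      have := hd.2 ⟨j, hj⟩
      rw [divDeg_restrict] at this
      change 1 ≤ twistedDiff D.coef f (⟨j, hj⟩ : Fin D.ℓ)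
      rw [this]; push_cast; linarith [Int.natCast_nonneg n])
  let i' : Fin (D.ℓ + 1) := ⟨i, by omega⟩
  refine ⟨i', fun ρ => ?_, fun j => ?_⟩
  · obtain ⟨g, hg, g0, g1, hg'⟩ := (D.exists_vertexDivisor i').choose_spec.2.2
    have := h g g0 g1 hg' ρ (by omega)
    have e : D.vertexDivisor i' ρ = g ρ := congrFun hg ρ
    simp only [Pi.sub_apply, Pi.zero_apply, e]
    linarith
  · rw [map_sub, Pi.sub_apply, hd.2, (vertexDivisor_mem i').2]
    push_cast; ring

lemma exists_degree_unit_le {d : D.Ray → ℤ} (h0 : 0 ≤ d) (hd : ∀ j, 0 ≤ D.divDeg d j)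
    {l : Fin D.ℓ} (hl : 1 ≤ D.divDeg d l) :
    ∃ e, 0 ≤ e ∧ e ≤ d ∧ D.divDeg e = Pi.single l 1 := by
  obtain ⟨f, rfl⟩ := D.exists_restrict d
  obtain ⟨g, hg, h⟩ := exists_unit_le (f := f) D.two_le_coef
    (fun j hj => h0 ⟨j, by omega⟩) (fun j hj => hd ⟨j, hj⟩) l.2 hl
  refine ⟨fun ρ => g ρ, fun ρ => (h ρ (by omega)).1, fun ρ => (h ρ (by omega)).2, ?_⟩
  ext j
  rw [divDeg_restrict, hg, Pi.single_apply]
  simp [Fin.ext_iff, eq_comm]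

lemma zero_mem_sectionDivisors : (0 : D.Ray → ℤ) ∈ D.sectionDivisors 0 :=
  ⟨le_rfl, fun j => by rw [map_zero]; rfl⟩

lemma sum_mem_sectionDivisors {ι : Type*} (s : Finset ι) (n : ι → ℕ) (d : ι → D.Ray → ℤ)
    (h : ∀ i ∈ s, d i ∈ D.sectionDivisors (n i)) :
    ∑ i ∈ s, d i ∈ D.sectionDivisors (∑ i ∈ s, n i) := by
  classical
  induction s using Finset.induction_on with
  | empty => exact zero_mem_sectionDivisors
  | insert a s ha ih =>
    rw [Finset.sum_insert ha, Finset.sum_insert ha]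
    exact add_mem_sectionDivisors (h a (by simp)) (ih fun i hi => h i (by simp [hi]))

/-- A character cutting out the face `s` of a maximal cone has the right divisor on the rays of that
cone. Elsewhere it may be negative, which a large multiple of the vertex divisor repairs without
changing the values on the cone. -/
lemma exists_sectionDivisor_of_cone (s : D.Fan) :
    ∃ n, 0 < n ∧ ∃ d ∈ D.sectionDivisors n, ∀ ρ, d ρ = 0 ↔ ρ ∈ s.1 := by
  obtain ⟨i, hi⟩ := s.2
  obtain ⟨⟨m, hm, hm'⟩, h0, h1⟩ := D.exists_face s.1 ⟨{i.castSucc, i.succ}, i, subset_rfl⟩ hi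
  let c := D.charDivHom ⟨m, hm⟩
  have hc : ∀ ρ, (D.r : ℤ) * c ρ = D.pair ρ m := D.r_mul_charDivHom ⟨m, hm⟩
  have hr : (0 : ℤ) < D.r := by exact_mod_cast D.r_pos
  -- The extra `1` makes the sum strictly positive off the maximal cone, and `N` itself positive.
  let N := ∑ ρ, (c ρ).natAbs + 1
  have hN : ∀ ρ, -(N : ℤ) < c ρ := by
    intro ρ
    have := Finset.single_le_sum (f := fun ρ => (c ρ).natAbs) (fun _ _ => Nat.zero_le _)
      (Finset.mem_univ ρ)
    omega
  have hv : ∀ ρ, ρ ∉ ({i.castSucc, i.succ} : Finset D.Ray) → 0 < N • D.vertexDivisor i ρ + c ρ := by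
    intro ρ hρ
    have h2 : 1 ≤ D.vertexDivisor i ρ :=
      lt_of_le_of_ne ((vertexDivisor_mem i).1 ρ)
        (fun h => hρ ((vertexDivisor_eq_zero_iff i ρ).mp h.symm))
    have h3 := hN ρ
    rw [nsmul_eq_mul]
    nlinarith
  have hz : ∀ ρ, ρ ∈ ({i.castSucc, i.succ} : Finset D.Ray) →
      N • D.vertexDivisor i ρ + c ρ = c ρ := by
    intro ρ hρ
    rw [(vertexDivisor_eq_zero_iff i ρ).mpr hρ, smul_zero, zero_add]
  refine ⟨N, by omega, N • D.vertexDivisor i + c, ⟨fun ρ => ?_, fun j => ?_⟩, fun ρ => ?_⟩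
  · change 0 ≤ N • D.vertexDivisor i ρ + c ρ
    by_cases hρ : ρ ∈ ({i.castSucc, i.succ} : Finset D.Ray)
    · rw [hz ρ hρ]
      exact (D.charDivHom_nonneg_iff ⟨m, hm⟩ ρ).mpr (hm' ρ hρ)
    · exact (hv ρ hρ).le
  · rw [map_add, map_nsmul, Pi.add_apply, Pi.smul_apply, (vertexDivisor_mem i).2,
      divDeg_charDivHom]
    simp
  · change N • D.vertexDivisor i ρ + c ρ = 0 ↔ _
    by_cases hρ : ρ ∈ ({i.castSucc, i.succ} : Finset D.Ray)
    · rw [hz ρ hρ]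
      by_cases hs : ρ ∈ s.1
      · have h2 : D.pair ρ m = 0 := h0 ρ hs
        rw [← hc, mul_eq_zero_iff_left hr.ne'] at h2
        simp [h2, hs]
      · have h2 : 0 < D.pair ρ m := h1 ρ hρ hs
        rw [← hc, mul_pos_iff_of_pos_left hr] at h2
        simp [h2.ne', hs]
    · exact ⟨fun h => absurd h (hv ρ hρ).ne', fun h => absurd (hi h) hρ⟩

/-- The degree of `coneDivisor s`. -/
def coneDegree (s : D.Fan) : ℕ := by
  classical
  exact ∑ t ∈ {t : D.Fan | s ≤ t}, (exists_sectionDivisor_of_cone t).choose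

/-- An effective divisor supported exactly on the rays outside the cone `s`, which decreases when
the cone becomes larger. -/
def coneDivisor (s : D.Fan) : D.Ray → ℤ := by
  classical
  -- Separate choices for the cones would be unrelated. Summing over all cones containing `s` makes
  -- the divisor of a face exceed that of a larger cone by an effective section divisor.
  exact ∑ t ∈ {t : D.Fan | s ≤ t}, (exists_sectionDivisor_of_cone t).choose_spec.2.choose

lemma coneDivisor_mem (s : D.Fan) : coneDivisor s ∈ D.sectionDivisors (coneDegree s) := by
  classical
  exact sum_mem_sectionDivisors _ _ _
    fun t _ => (exists_sectionDivisor_of_cone t).choose_spec.2.choose_spec.1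

lemma coneDegree_pos (s : D.Fan) : 0 < coneDegree s := by
  classical
  exact Finset.sum_pos (fun t _ => (exists_sectionDivisor_of_cone t).choose_spec.1)
    ⟨s, by simp⟩

lemma coneDivisor_eq_zero_iff (s : D.Fan) (ρ : D.Ray) : coneDivisor s ρ = 0 ↔ ρ ∈ s.1 := by
  classical
  have h := fun t : D.Fan => (exists_sectionDivisor_of_cone t).choose_spec.2.choose_spec
  rw [coneDivisor, Finset.sum_apply, Finset.sum_eq_zero_iff_of_nonneg fun t _ => (h t).1.1 ρ]
  refine ⟨fun h2 => ((h s).2 ρ).mp (h2 s (by simp)), fun hs t ht => ((h t).2 ρ).mpr ?_⟩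
  exact (Finset.mem_filter.mp ht).2 hs

/-- Every cone containing `t` contains `s`, so the sum for `s` only has additional terms. This exact
divisibility supplies the restriction maps between charts. -/
lemma exists_coneDivisor_eq_add {s t : D.Fan} (hst : s ≤ t) :
    ∃ n, coneDegree s = coneDegree t + n ∧
      ∃ d ∈ D.sectionDivisors n, coneDivisor s = coneDivisor t + d := by
  classical
  have hsub : (Finset.univ.filter fun u : D.Fan => t ≤ u) ⊆
      Finset.univ.filter fun u : D.Fan => s ≤ u := by
    intro u hu
    simp only [Finset.mem_filter, Finset.mem_univ, true_and] at hu ⊢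
    exact hst.trans hu
  refine ⟨_, ?_, _, sum_mem_sectionDivisors ((Finset.univ.filter fun u : D.Fan => s ≤ u) \
    Finset.univ.filter fun u : D.Fan => t ≤ u) _ _
    fun u _ => (exists_sectionDivisor_of_cone u).choose_spec.2.choose_spec.1, ?_⟩
  · exact (add_comm _ _).trans (Finset.sum_sdiff hsub) |>.symm
  · exact (add_comm _ _).trans (Finset.sum_sdiff hsub) |>.symm

/-- A divisor which is nonnegative on the rays of the cone `s` becomes effective after adding a
multiple of a divisor which is positive outside `s`. -/
lemma exists_nsmul_add_nonneg {s : Finset D.Ray} {g c : D.Ray → ℤ} (hg : 0 ≤ g)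
    (hgs : ∀ ρ, g ρ = 0 → ρ ∈ s) (hc : ∀ ρ ∈ s, 0 ≤ c ρ) : ∃ n : ℕ, 0 ≤ c + n • g := by
  refine ⟨∑ ρ, (c ρ).natAbs, fun ρ => ?_⟩
  have h1 := Finset.single_le_sum (f := fun ρ => (c ρ).natAbs) (fun _ _ => Nat.zero_le _)
    (Finset.mem_univ ρ)
  have h2 : 0 ≤ g ρ := hg ρ
  rw [Pi.add_apply, Pi.smul_apply, nsmul_eq_mul, Pi.zero_apply]
  by_cases hρ : ρ ∈ s
  · exact add_nonneg (hc ρ hρ) (by positivity)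
  · have h3 : 1 ≤ g ρ := lt_of_le_of_ne h2 fun h => hρ (hgs ρ h.symm)
    have h4 : -((∑ ρ, (c ρ).natAbs : ℕ) : ℤ) ≤ c ρ := by omega
    nlinarith

end CyclicQuotientType

/-! ### The coordinate ring of `𝕍(I_Q)` inside the Laurent polynomials in the Cox variables. -/

namespace CyclicQuotientType

variable {D : CyclicQuotientType}

/-- The line bundles `L` are trivial for `i = 0` and dual to the exceptional curves otherwise. -/
def IsDualCollection (L : Fin (D.ℓ + 1) → D.Pic) : Prop :=
  L 0 = 0 ∧ ∀ i j : Fin D.ℓ, D.degOn j (L i.succ) = if i = j then 1 else 0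

variable {L : Fin (D.ℓ + 1) → D.Pic}

lemma IsDualCollection.degOn (hL : IsDualCollection L) (i : Fin (D.ℓ + 1)) (j : Fin D.ℓ) :
    D.degOn j (L i) = (Pi.single i 1 : Fin (D.ℓ + 1) → ℤ) j.succ := by
  refine Fin.cases ?_ (fun i => ?_) i
  · rw [hL.1, map_zero, Pi.single_apply, if_neg (Fin.succ_ne_zero j)]
  · rw [hL.2, Pi.single_apply]
    simp [eq_comm]

/-- The divisor with integral coefficients of an effective divisor. -/
def intDiv : (D.Ray → ℕ) →+ (D.Ray → ℤ) where
  toFun d ρ := d ρ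
  map_zero' := by ext; simp
  map_add' d e := by ext; simp

lemma intDiv_apply (d : D.Ray → ℕ) (ρ : D.Ray) : intDiv d ρ = d ρ := rfl

lemma intDiv_injective : Function.Injective (intDiv (D := D)) := fun d e h => by
  ext ρ
  exact Int.ofNat.inj (congrFun h ρ)

lemma intDiv_nonneg (d : D.Ray → ℕ) : 0 ≤ intDiv d := fun ρ => by simp [intDiv_apply]

lemma exists_intDiv {d : D.Ray → ℤ} (hd : 0 ≤ d) : ∃ e, intDiv e = d :=
  ⟨fun ρ => (d ρ).toNat, by ext ρ; exact Int.toNat_of_nonneg (hd ρ)⟩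

/-- Classes in `Pic` are detected by degrees, which turns being a section into a condition on
weights. -/
lemma IsDualCollection.isSectionDivisor_iff (hL : IsDualCollection L) (i j : Fin (D.ℓ + 1))
    (d : D.Ray → ℕ) :
    IsSectionDivisor L i j d ↔ D.weightOf (intDiv d) = Pi.single j 1 - Pi.single i 1 := by
  rw [weightOf_eq_iff _ (by simp)]
  constructor
  · intro h l
    have := congrArg (D.degOn l) h
    rw [map_sub, hL.degOn, hL.degOn] at this
    exact this
  · intro h
    refine sub_eq_zero.mp (D.eq_zero_of_degOn_eq_zero fun l => ?_)
    rw [map_sub, map_sub, hL.degOn, hL.degOn]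
    exact sub_eq_zero.mpr (h l)

lemma IsDualCollection.weightOf_label (hL : IsDualCollection L) (b : Arrow L) :
    D.weightOf (intDiv b.label) = b.inc :=
  (hL.isSectionDivisor_iff _ _ _).mp b.irreducible.1

/-- The `div` component of `π` determines the `inc` component; hence forgetting `inc` does not
enlarge the kernel `I_Q`. -/
lemma IsDualCollection.weightOf_incDiv (hL : IsDualCollection L) (u : Arrow L →₀ ℕ) :
    D.weightOf (intDiv (incDiv L u).2) = (incDiv L u).1 := by
  simp only [incDiv, Finsupp.sum, map_sum, map_nsmul, hL.weightOf_label]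

lemma incDiv_add (u v : Arrow L →₀ ℕ) : incDiv L (u + v) = incDiv L u + incDiv L v :=
  Prod.ext
    (Finsupp.sum_add_index' (h := fun (b : Arrow L) (e : ℕ) => e • b.inc)
      (fun b => zero_nsmul b.inc) (fun b m n => add_nsmul b.inc m n))
    (Finsupp.sum_add_index' (h := fun (b : Arrow L) (e : ℕ) => e • b.label)
      (fun b => zero_nsmul b.label) (fun b m n => add_nsmul b.label m n))

variable {k : Type*} [Field k]

/-- An arbitrary `φ` is allowed because this serves both the map to the Cox variables and the map to
the plane. -/
lemma aeval_label_monomial {R : Type*} [CommRing R] [Algebra k R]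
    (φ : Multiplicative (D.Ray → ℕ) →* R) (u : Arrow L →₀ ℕ) (c : k) :
    MvPolynomial.aeval (fun b : Arrow L => φ (Multiplicative.ofAdd b.label))
      (MvPolynomial.monomial u c) = c • φ (Multiplicative.ofAdd (incDiv L u).2) := by
  have h : (incDiv L u).2 = ∑ b ∈ u.support, u b • b.label := rfl
  rw [MvPolynomial.aeval_monomial, Algebra.smul_def, h, ofAdd_sum, map_prod]
  simp only [ofAdd_nsmul, map_pow]
  rfl

lemma aeval_label_eq_zero {R : Type*} [CommRing R] [Algebra k R]
    (φ : Multiplicative (D.Ray → ℕ) →* R) (P : MvPolynomial (Arrow L) k)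
    (hP : P ∈ toricIdeal L k) :
    MvPolynomial.aeval (fun b : Arrow L => φ (Multiplicative.ofAdd b.label)) P = 0 := by
  have h : toricIdeal L k ≤ RingHom.ker (MvPolynomial.aeval (R := k)
      (fun b : Arrow L => φ (Multiplicative.ofAdd b.label))).toRingHom := by
    refine Ideal.span_le.mpr ?_
    rintro _ ⟨u, v, huv, rfl⟩
    change MvPolynomial.aeval _ _ = 0
    rw [map_sub, aeval_label_monomial, aeval_label_monomial, huv, sub_self]
  exact h hP

variable (D k) in
/-- The Laurent polynomial ring in the variables of the total coordinate ring. -/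
abbrev CoxRing : Type _ := AddMonoidAlgebra k (D.Ray → ℤ)

variable (D k) in
/-- The Laurent monomial `x ^ d` of an effective divisor `d`. -/
def coxMonomial : Multiplicative (D.Ray → ℕ) →* D.CoxRing k :=
  (AddMonoidAlgebra.of k (D.Ray → ℤ)).comp (AddMonoidHom.toMultiplicative intDiv)

lemma coxMonomial_apply (d : D.Ray → ℕ) :
    coxMonomial D k (Multiplicative.ofAdd d) = AddMonoidAlgebra.single (intDiv d) 1 := rfl

variable (L k) in
/-- The homomorphism `y_b ↦ x ^ div(b)` from the coordinate ring of `𝕍(I_Q)` to the ring of Laurent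
polynomials in the variables of the total coordinate ring. -/
def coxMap : ToricRing L k →ₐ[k] D.CoxRing k :=
  Ideal.Quotient.liftₐ (toricIdeal L k) _ (aeval_label_eq_zero (coxMonomial D k))

lemma coxMap_mk_monomial (u : Arrow L →₀ ℕ) (c : k) :
    coxMap L k (Ideal.Quotient.mk _ (MvPolynomial.monomial u c)) =
      AddMonoidAlgebra.single (intDiv (incDiv L u).2) c := by
  refine (aeval_label_monomial (coxMonomial D k) u c).trans ?_
  rw [coxMonomial_apply, AddMonoidAlgebra.smul_single, smul_eq_mul, mul_one]

lemma mk_monomial_eq {u v : Arrow L →₀ ℕ} (h : incDiv L u = incDiv L v) (c : k) :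
    Ideal.Quotient.mk (toricIdeal L k) (MvPolynomial.monomial u c) =
      Ideal.Quotient.mk (toricIdeal L k) (MvPolynomial.monomial v c) := by
  rw [Ideal.Quotient.eq]
  have e : MvPolynomial.monomial u c - MvPolynomial.monomial v c =
      MvPolynomial.C c * (MvPolynomial.monomial u 1 - MvPolynomial.monomial v 1) := by
    rw [mul_sub, MvPolynomial.C_mul_monomial, MvPolynomial.C_mul_monomial, mul_one]
  rw [e]
  exact Ideal.mul_mem_left _ _ (Ideal.subset_span ⟨u, v, h, rfl⟩)

/-- A left inverse sends each `x ^ d` to a chosen monomial with divisor `d`. Any two monomials with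
the same divisor have the same `π`, hence agree modulo `I_Q`. -/
lemma IsDualCollection.coxMap_injective (hL : IsDualCollection L) :
    Function.Injective (coxMap L k) := by
  classical
  -- The default `0` is only taken at divisors outside the image, so it plays no role.
  let rep : (D.Ray → ℤ) → (Arrow L →₀ ℕ) := fun d =>
    if h : ∃ u : Arrow L →₀ ℕ, intDiv (incDiv L u).2 = d then h.choose else 0
  have hrep : ∀ u : Arrow L →₀ ℕ, incDiv L (rep (intDiv (incDiv L u).2)) = incDiv L u := by
    intro u
    have h : ∃ v : Arrow L →₀ ℕ, intDiv (incDiv L v).2 = intDiv (incDiv L u).2 := ⟨u, rfl⟩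
    have h2 : rep (intDiv (incDiv L u).2) = h.choose := dif_pos h
    rw [h2]
    refine Prod.ext ?_ (intDiv_injective h.choose_spec)
    rw [← hL.weightOf_incDiv, ← hL.weightOf_incDiv, h.choose_spec]
  let g : D.CoxRing k → ToricRing L k := fun z => z.coeff.sum fun d c =>
    Ideal.Quotient.mk _ (MvPolynomial.monomial (rep d) c)
  refine Function.LeftInverse.injective (g := g) fun x => ?_
  obtain ⟨P, rfl⟩ := Ideal.Quotient.mk_surjective x
  have hg : ∀ y z, g (y + z) = g y + g z := fun y z =>
    Finsupp.sum_add_index' (by simp) (by simp)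
  induction P using MvPolynomial.induction_on' with
  | monomial u c =>
    rw [coxMap_mk_monomial, ← mk_monomial_eq (hrep u) c]
    exact Finsupp.sum_single_index (by simp)
  | add p q hp hq => rw [map_add, map_add, hg, hp, hq]

/-- Elements of weight `θ` are sums of monomials of weight `θ`. -/
lemma weightGrading_induction {θ : Fin (D.ℓ + 1) → ℤ} {p : ToricRing L k → Prop} (h0 : p 0)
    (hadd : ∀ x y, p x → p y → p (x + y))
    (hmono : ∀ (u : Arrow L →₀ ℕ) (c : k), (incDiv L u).1 = θ →
      p (Ideal.Quotient.mk _ (MvPolynomial.monomial u c)))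
    {x : ToricRing L k} (hx : x ∈ weightGrading L k θ) : p x := by
  obtain ⟨P, hP, rfl⟩ := hx
  change p (Ideal.Quotient.mk _ P)
  rw [P.as_sum, map_sum]
  refine Finset.sum_induction _ p hadd h0 fun u hu => hmono u _ ?_
  exact hP (MvPolynomial.mem_support_iff.mp hu)

lemma mk_monomial_mem_weightGrading (u : Arrow L →₀ ℕ) (c : k) :
    Ideal.Quotient.mk (toricIdeal L k) (MvPolynomial.monomial u c) ∈
      weightGrading L k (incDiv L u).1 :=
  ⟨MvPolynomial.monomial u c, MvPolynomial.isWeightedHomogeneous_monomial _ _ _ rfl, rfl⟩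

/-- The divisors of the torus-invariant sections that lie in the semigroup generated by the
arrows. -/
def arrowDivisors (L : Fin (D.ℓ + 1) → D.Pic) : AddSubmonoid (D.Ray → ℕ) where
  carrier := {d | ∃ u : Arrow L →₀ ℕ, (incDiv L u).2 = d}
  zero_mem' := ⟨0, rfl⟩
  add_mem' := by
    rintro _ _ ⟨u, rfl⟩ ⟨v, rfl⟩
    exact ⟨u + v, by rw [incDiv_add]; rfl⟩

/-- A reducible section splits into two nonzero divisors, each with smaller sum of coefficients, so
factoring stops at arrows. -/
lemma mem_arrowDivisors_of_isSectionDivisor {i j : Fin (D.ℓ + 1)} {d : D.Ray → ℕ}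
    (hd : IsSectionDivisor L i j d) : d ∈ arrowDivisors L := by
  induction hN : ∑ ρ, d ρ using Nat.strong_induction_on generalizing i j d with
  | _ N ih =>
    have hpos : ∀ e : D.Ray → ℕ, e ≠ 0 → 0 < ∑ ρ, e ρ := by
      intro e he
      refine Nat.pos_of_ne_zero fun h => he (funext fun ρ => ?_)
      exact (Finset.sum_eq_zero_iff.mp h) ρ (Finset.mem_univ ρ)
    by_cases h0 : d = 0
    · exact h0 ▸ zero_mem _
    by_cases hirr : IsIrreducibleSection L i j d
    · refine ⟨Finsupp.single ⟨i, j, d, hirr⟩ 1, ?_⟩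
      exact (Finsupp.sum_single_index (h := fun (b : Arrow L) (e : ℕ) => e • b.label)
        (zero_nsmul _)).trans (one_nsmul _)
    · simp only [IsIrreducibleSection, not_and, not_forall, not_or] at hirr
      obtain ⟨l, d₁, d₂, h1, h2, rfl, hd1, hd2⟩ := hirr hd h0
      simp only [Pi.add_apply, Finset.sum_add_distrib] at hN
      have p1 := hpos d₁ hd1
      have p2 := hpos d₂ hd2
      exact add_mem (ih _ (by omega) h1 rfl) (ih _ (by omega) h2 rfl)

/-- The semigroup generated by the arrows contains all effective divisors of nonnegative degree. -/
lemma IsDualCollection.mem_arrowDivisors (hL : IsDualCollection L) {d : D.Ray → ℕ}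
    (hd : ∀ j, 0 ≤ D.divDeg (intDiv d) j) : d ∈ arrowDivisors L := by
  -- Induction on the total degree. In total degree zero the divisor is that of a section from
  -- vertex `0` to itself.
  induction hN : ∑ j, (D.divDeg (intDiv d) j).toNat generalizing d with
  | zero =>
    have h : D.weightOf (intDiv d) = Pi.single 0 1 - Pi.single 0 1 := by
      rw [weightOf_eq_iff _ (by simp)]
      intro j
      have := Finset.sum_eq_zero_iff.mp hN j (Finset.mem_univ j)
      have h2 := hd j
      rw [sub_self, Pi.zero_apply]
      omega
    exact mem_arrowDivisors_of_isSectionDivisor ((hL.isSectionDivisor_iff 0 0 d).mpr h)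
  | succ N ih =>
    obtain ⟨l, -, hl⟩ : ∃ l ∈ Finset.univ, 0 < (D.divDeg (intDiv d) l).toNat :=
      Finset.exists_lt_of_sum_lt (f := fun _ => 0) (by simp [hN])
    -- Convexity splits off a section from vertex `0` to vertex `l.succ`, leaving an effective
    -- divisor whose degrees are still nonnegative.
    obtain ⟨e, he0, hed, he⟩ := exists_degree_unit_le (intDiv_nonneg d) hd (l := l) (by omega)
    obtain ⟨e, rfl⟩ := exists_intDiv he0
    obtain ⟨c, hc⟩ := exists_intDiv (sub_nonneg.mpr hed)
    obtain rfl : e + c = d := intDiv_injective (by rw [map_add, hc]; abel)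
    have he' : IsSectionDivisor L 0 l.succ e := by
      rw [hL.isSectionDivisor_iff, weightOf_eq_iff _ (by simp)]
      intro j
      rw [he]
      simp [Pi.single_apply, Fin.succ_ne_zero]
    have hsum : ∀ j, D.divDeg (intDiv (e + c)) j =
        (if j = l then 1 else 0) + D.divDeg (intDiv c) j := fun j => by
      rw [map_add, map_add, he, Pi.add_apply, Pi.single_apply]
    have hc0 : ∀ j, 0 ≤ D.divDeg (intDiv c) j := fun j => by
      have h1 := hsum j
      have h2 := hd j
      split_ifs at h1 with h
      · subst h; omega
      · omega
    refine add_mem (mem_arrowDivisors_of_isSectionDivisor he') (ih hc0 ?_)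
    have h1 : ∀ j, (D.divDeg (intDiv (e + c)) j).toNat =
        (if j = l then 1 else 0) + (D.divDeg (intDiv c) j).toNat := fun j => by
      have h1 := hsum j
      have h2 := hc0 j
      split_ifs at h1 ⊢ <;> omega
    rw [Finset.sum_congr rfl fun j _ => h1 j, Finset.sum_add_distrib, Finset.sum_ite_eq'] at hN
    simp only [Finset.mem_univ, if_true] at hN
    omega

/-- Every effective divisor of nonnegative degree is the image of a monomial. -/
lemma IsDualCollection.exists_coxMap_eq_single (hL : IsDualCollection L) {d : D.Ray → ℤ}
    (h0 : 0 ≤ d) (hd : ∀ j, 0 ≤ D.divDeg d j) :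
    ∃ x ∈ weightGrading L k (D.weightOf d), coxMap L k x = AddMonoidAlgebra.single d 1 := by
  obtain ⟨d, rfl⟩ := exists_intDiv h0
  obtain ⟨u, rfl⟩ := hL.mem_arrowDivisors hd
  rw [hL.weightOf_incDiv]
  exact ⟨_, mk_monomial_mem_weightGrading u 1, coxMap_mk_monomial u 1⟩

end CyclicQuotientType

/-! ### Morphisms of projective spectra induced by graded homomorphisms. -/

section ProjMap

open HomogeneousLocalization HomogeneousIdeal

universe u

variable {A B σ τ : Type u} [CommRing A] [SetLike σ A] [AddSubgroupClass σ A]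
  [CommRing B] [SetLike τ B] [AddSubgroupClass τ B]
  {𝒜 : ℕ → σ} {ℬ : ℕ → τ} [GradedRing 𝒜] [GradedRing ℬ]

lemma HomogeneousLocalization.Away.map_surjective (g : 𝒜 →+*ᵍ ℬ)
    (hs : ∀ n, ∀ b ∈ ℬ n, ∃ a ∈ 𝒜 n, g a = b) {n : ℕ} {f : A} (hf : f ∈ 𝒜 n) :
    Function.Surjective (Away.map g f : Away 𝒜 f →+* Away ℬ (g f)) := by
  intro x
  obtain ⟨m, b, hb, rfl⟩ := Away.mk_surjective ℬ (g.2 hf) x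
  obtain ⟨a, ha, rfl⟩ := hs _ b hb
  exact ⟨Away.mk 𝒜 hf m a ha, Away.map_mk g f hf m a ha⟩

lemma HomogeneousIdeal.irrelevant_le_map_of_surjective (g : 𝒜 →+*ᵍ ℬ)
    (hs : ∀ n, ∀ b ∈ ℬ n, ∃ a ∈ 𝒜 n, g a = b) : irrelevant ℬ ≤ (irrelevant 𝒜).map g := by
  refine (irrelevant_le ℬ).mpr fun n hn b hb => ?_
  obtain ⟨a, ha, rfl⟩ := hs n b hb
  exact Ideal.mem_map_of_mem g (mem_irrelevant_of_mem 𝒜 hn ha)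

/-- A surjective homomorphism of graded rings induces a closed immersion of projective spectra. -/
lemma AlgebraicGeometry.Proj.isClosedImmersion_map (g : 𝒜 →+*ᵍ ℬ)
    (hg : irrelevant ℬ ≤ (irrelevant 𝒜).map g)
    (hs : ∀ n, ∀ b ∈ ℬ n, ∃ a ∈ 𝒜 n, g a = b) : IsClosedImmersion (Proj.map g hg) := by
  refine IsZariskiLocalAtTarget.of_openCover (Proj.affineOpenCover 𝒜).openCover ?_
  rintro ⟨⟨n, hn⟩, ⟨f, hf'⟩⟩
  have hf : f ∈ 𝒜 n := hf'
  have hgf : g f ∈ ℬ n := g.2 hf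
  have h := Proj.awayι_comp_map g hg hn f hf
  -- The preimage of the basic open of `f` is the basic open of `g f`, so over this chart the
  -- morphism is `Spec` of a surjection.
  have hp : IsPullback (Spec.map (CommRingCat.ofHom (Away.map g f)))
      (Proj.awayι ℬ (g f) hgf hn) (Proj.awayι 𝒜 f hf hn) (Proj.map g hg) := by
    refine IsOpenImmersion.isPullback _ _ _ _ h ?_
    rw [Proj.opensRange_awayι, Proj.opensRange_awayι, Proj.map_preimage_basicOpen]
  have : IsClosedImmersion (Spec.map (CommRingCat.ofHom (Away.map g f))) :=
    IsClosedImmersion.spec_of_surjective _ (Away.map_surjective g hs hf)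
  have e : hp.flip.isoPullback.inv ≫ Spec.map (CommRingCat.ofHom (Away.map g f)) =
      pullback.snd (Proj.map g hg) (Proj.awayι 𝒜 f hf hn) :=
    hp.flip.isoPullback_inv_snd
  change IsClosedImmersion (pullback.snd (Proj.map g hg) (Proj.awayι 𝒜 f hf hn))
  rw [← e]
  infer_instance

/-- The restriction of a homomorphism of graded rings to degree zero. -/
def GradedRingHom.degreeZero (g : 𝒜 →+*ᵍ ℬ) : 𝒜 0 →+* ℬ 0 where
  toFun a := ⟨g a.1, g.2 a.2⟩
  map_one' := Subtype.ext (map_one g)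
  map_zero' := Subtype.ext (map_zero g)
  map_add' a b := Subtype.ext (map_add g a.1 b.1)
  map_mul' a b := Subtype.ext (map_mul g a.1 b.1)

lemma AlgebraicGeometry.Proj.map_toSpecZero (g : 𝒜 →+*ᵍ ℬ)
    (hg : irrelevant ℬ ≤ (irrelevant 𝒜).map g) :
    Proj.map g hg ≫ Proj.toSpecZero 𝒜 =
      Proj.toSpecZero ℬ ≫ Spec.map (CommRingCat.ofHom g.degreeZero) := by
  refine (Proj.mapAffineOpenCover g hg).openCover.hom_ext _ _ ?_
  rintro ⟨⟨n, hn⟩, ⟨f, hf'⟩⟩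
  have hf : f ∈ 𝒜 n := hf'
  have hgf : g f ∈ ℬ n := g.2 hf
  change Proj.awayι ℬ (g f) hgf hn ≫ _ = Proj.awayι ℬ (g f) hgf hn ≫ _
  rw [← Category.assoc, ← Category.assoc, Proj.awayι_comp_map g hg hn f hf,
    Category.assoc, Proj.awayι_toSpecZero, Proj.awayι_toSpecZero, ← Spec.map_comp, ← Spec.map_comp]
  congr 1
  ext x
  change (Away.map g f (fromZeroRingHom 𝒜 _ x)).val = (fromZeroRingHom ℬ _ (g.degreeZero x)).val
  change Localization.mk (g x.1) _ = Localization.mk (g x.1) _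
  congr 1
  exact Subtype.ext (map_one g)

end ProjMap

/-! ### Recognising a scheme as the gluing of its charts. -/

section Colimit

open TopologicalSpace Topology

universe w v u

/-- Two out of three on stalks: `i` and `i ≫ f` both induce isomorphisms there. -/
lemma AlgebraicGeometry.Scheme.Hom.isIso_stalkMap_of_comp {U X Y : Scheme.{u}} (i : U ⟶ X)
    (f : X ⟶ Y) [IsOpenImmersion i] [IsOpenImmersion (i ≫ f)] (x : U) :
    IsIso (f.stalkMap (i x)) := by
  have : IsIso (f.stalkMap (i x) ≫ i.stalkMap x) := by
    rw [← Scheme.Hom.stalkMap_comp]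
    exact (IsOpenImmersion.iff_isIso_stalkMap.mp ‹IsOpenImmersion (i ≫ f)›).2 x
  exact IsIso.of_isIso_comp_right _ (i.stalkMap x)

variable {J : Type w} [Category.{v} J] (F : J ⥤ Scheme.{u})
  [∀ {i j} (f : i ⟶ j), IsOpenImmersion (F.map f)] [(F ⋙ Scheme.forget).IsLocallyDirected]
  [Quiver.IsThin J] [Small.{u} J]

/-- A jointly surjective cocone of open immersions, for which the intersections of the charts are
covered by charts, is the colimit of a locally directed diagram. -/
lemma AlgebraicGeometry.Scheme.isIso_colimit_desc (c : Cocone F)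
    [∀ i, IsOpenImmersion (c.ι.app i)]
    (hsurj : ∀ x : c.pt, ∃ i y, c.ι.app i y = x)
    (hinter : ∀ i j x y, c.ι.app i x = c.ι.app j y →
      ∃ (l : J) (_ : l ⟶ i) (_ : l ⟶ j), ∃ z, c.ι.app l z = c.ι.app i x) :
    IsIso (colimit.desc F c) := by
  have hι : ∀ i, colimit.ι F i ≫ colimit.desc F c = c.ι.app i := fun i => colimit.ι_desc c i
  have hιa : ∀ i x, colimit.desc F c (colimit.ι F i x) = c.ι.app i x := fun i x => by
    rw [← Scheme.Hom.comp_apply, hι]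
  have hcompat : ∀ {i j} (f : i ⟶ j) (z : F.obj i), c.ι.app j (F.map f z) = c.ι.app i z := by
    intro i j f z
    rw [← Scheme.Hom.comp_apply, c.w]
  -- Points with the same image come from a common smaller chart, and are therefore already
  -- identified in the colimit.
  have hinj : Function.Injective (colimit.desc F c) := by
    intro x y hxy
    obtain ⟨i, x, rfl⟩ := Scheme.IsLocallyDirected.ι_jointly_surjective F x
    obtain ⟨j, y, rfl⟩ := Scheme.IsLocallyDirected.ι_jointly_surjective F y
    rw [hιa, hιa] at hxy
    obtain ⟨l, fi, fj, z, hz⟩ := hinter i j x y hxy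
    refine (Scheme.IsLocallyDirected.ι_eq_ι_iff F).mpr ⟨l, fi, fj, z, ?_, ?_⟩
    · apply (c.ι.app i).isOpenEmbedding.injective
      rw [hcompat, hz]
    · apply (c.ι.app j).isOpenEmbedding.injective
      rw [hcompat, hz, hxy]
  have hopen : IsOpenMap (colimit.desc F c) := by
    intro U hU
    have e : colimit.desc F c '' U =
        ⋃ i, c.ι.app i '' (colimit.ι F i ⁻¹' U) := by
      ext y
      simp only [Set.mem_image, Set.mem_iUnion]
      constructor
      · rintro ⟨x, hx, rfl⟩
        obtain ⟨i, x, rfl⟩ := Scheme.IsLocallyDirected.ι_jointly_surjective F x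
        exact ⟨i, x, hx, (hιa i x).symm⟩
      · rintro ⟨i, x, hx, rfl⟩
        exact ⟨_, hx, hιa i x⟩
    rw [e]
    exact isOpen_iUnion fun i => (c.ι.app i).isOpenEmbedding.isOpenMap _
      (hU.preimage (colimit.ι F i).continuous)
  have hemb : IsOpenEmbedding (colimit.desc F c) :=
    .of_continuous_injective_isOpenMap (colimit.desc F c).continuous hinj hopen
  have hstalk : ∀ x, IsIso ((colimit.desc F c).stalkMap x) := by
    intro x
    obtain ⟨i, x, rfl⟩ := Scheme.IsLocallyDirected.ι_jointly_surjective F x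
    have : IsOpenImmersion (colimit.ι F i ≫ colimit.desc F c) := by
      rw [hι]
      infer_instance
    exact Scheme.Hom.isIso_stalkMap_of_comp (colimit.ι F i) _ x
  have := IsOpenImmersion.of_isIso_stalkMap _ hemb
  have hepi : Epi (colimit.desc F c).base := (TopCat.epi_iff_surjective _).mpr fun x => by
    obtain ⟨i, y, rfl⟩ := hsurj x
    exact ⟨_, hιa i y⟩
  exact IsOpenImmersion.isIso _

end Colimit

/-! ### Projectivity from finitely many generators of degree one. -/

section Generators

universe u

variable {R B τ : Type u} [CommRing R] [CommRing B] [SetLike τ B] [AddSubgroupClass τ B]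
  {ℬ : ℕ → τ} [GradedRing ℬ] {n : ℕ}

/-- The graded homomorphism from a polynomial ring given by elements of degree one. -/
def gradedEval (f : R →+* ℬ 0) (s : Fin (n + 1) → B) (hs : ∀ i, s i ∈ ℬ 1) :
    MvPolynomial.homogeneousSubmodule (Fin (n + 1)) R →+*ᵍ ℬ where
  toRingHom := MvPolynomial.eval₂Hom ((SetLike.GradeZero.subring ℬ).subtype.comp f) s
  map_mem := by
    intro m P hP
    change MvPolynomial.eval₂ _ s P ∈ _
    rw [MvPolynomial.eval₂_eq]
    refine sum_mem fun v hv => ?_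
    have h1 : ∑ i ∈ v.support, v i • 1 = m := by
      have := hP (MvPolynomial.mem_support_iff.mp hv)
      rw [Finsupp.weight_apply, Finsupp.sum] at this
      exact this
    rw [← zero_add m, ← h1]
    exact SetLike.mul_mem_graded (f _).2
      (SetLike.prod_pow_mem_graded _ _ _ _ fun i _ => hs i)

lemma gradedEval_C (f : R →+* ℬ 0) (s : Fin (n + 1) → B) (hs : ∀ i, s i ∈ ℬ 1) (x : R) :
    gradedEval f s hs (MvPolynomial.C x) = (f x : B) :=
  MvPolynomial.eval₂_C _ _ _

lemma gradedEval_X (f : R →+* ℬ 0) (s : Fin (n + 1) → B) (hs : ∀ i, s i ∈ ℬ 1)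
    (i : Fin (n + 1)) : gradedEval f s hs (MvPolynomial.X i) = s i :=
  MvPolynomial.eval₂_X _ _ _

lemma gradedEval_surjective (f : R →+* ℬ 0) (s : Fin (n + 1) → B) (hs : ∀ i, s i ∈ ℬ 1)
    (hf : Function.Surjective f)
    (hgen : ∀ m, ∀ b ∈ ℬ (m + 1), b ∈ AddSubgroup.closure {b' * s i | (b' ∈ ℬ m) (i)})
    (m : ℕ) (b : B) (hb : b ∈ ℬ m) :
    ∃ P ∈ MvPolynomial.homogeneousSubmodule (Fin (n + 1)) R m, gradedEval f s hs P = b := by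
  induction m generalizing b with
  | zero =>
    obtain ⟨x, hx⟩ := hf ⟨b, hb⟩
    exact ⟨MvPolynomial.C x, MvPolynomial.isHomogeneous_C _ _,
      (gradedEval_C f s hs x).trans (congrArg Subtype.val hx)⟩
  | succ m ih =>
    have h := hgen m b hb
    -- Preimages are produced for every element of the closure, so homogeneity of `b` is no longer
    -- needed.
    clear hb
    induction h using AddSubgroup.closure_induction with
    | zero => exact ⟨0, zero_mem _, map_zero _⟩
    | mem b h =>
      obtain ⟨b', hb', i, rfl⟩ := h
      obtain ⟨P, hP, rfl⟩ := ih b' hb'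
      exact ⟨P * MvPolynomial.X i, MvPolynomial.IsHomogeneous.mul hP
        (MvPolynomial.isHomogeneous_X _ i), (map_mul _ _ _).trans
        (congrArg _ (gradedEval_X f s hs i))⟩
    | add x y _ _ hx hy =>
      obtain ⟨P, hP, rfl⟩ := hx
      obtain ⟨Q, hQ, rfl⟩ := hy
      exact ⟨P + Q, add_mem hP hQ, map_add _ _ _⟩
    | neg x _ hx =>
      obtain ⟨P, hP, rfl⟩ := hx
      exact ⟨-P, neg_mem hP, map_neg _ _⟩

/-- If a graded ring is generated in degree one over its degree zero part by finitely many
elements, then its projective spectrum is projective over the degree zero part. -/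
theorem isProjectiveMorphism_toSpecZero (f : R →+* ℬ 0) (s : Fin (n + 1) → B)
    (hs : ∀ i, s i ∈ ℬ 1) (hf : Function.Surjective f)
    (hgen : ∀ m, ∀ b ∈ ℬ (m + 1), b ∈ AddSubgroup.closure {b' * s i | (b' ∈ ℬ m) (i)}) :
    IsProjectiveMorphism (Proj.toSpecZero ℬ ≫ Spec.map (CommRingCat.ofHom f)) := by
  have hsurj := gradedEval_surjective f s hs hf hgen
  have hg := HomogeneousIdeal.irrelevant_le_map_of_surjective (gradedEval f s hs) hsurj
  refine ⟨n, Proj.map (gradedEval f s hs) hg, Proj.isClosedImmersion_map _ hg hsurj, ?_⟩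
  change Proj.map _ hg ≫ Proj.toSpecZero _ ≫ Spec.map _ = Proj.toSpecZero _ ≫ Spec.map _
  rw [← Category.assoc, Proj.map_toSpecZero, Category.assoc, ← Spec.map_comp]
  congr 2
  exact CommRingCat.hom_ext (RingHom.ext fun x => Subtype.ext (gradedEval_C f s hs x))

end Generators

/-! ### The ring of semi-invariants as a section ring. -/

namespace CyclicQuotientType

variable {D : CyclicQuotientType} {L : Fin (D.ℓ + 1) → D.Pic} {k : Type*} [Field k]

lemma IsDualCollection.mem_support_coxMap (hL : IsDualCollection L) {θ : Fin (D.ℓ + 1) → ℤ}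
    {x : ToricRing L k} (hx : x ∈ weightGrading L k θ) :
    ∀ d ∈ (coxMap L k x).coeff.support, 0 ≤ d ∧ D.weightOf d = θ := by
  classical
  refine weightGrading_induction
    (p := fun x => ∀ d ∈ (coxMap L k x).coeff.support, 0 ≤ d ∧ D.weightOf d = θ)
    ?_ (fun x y hx hy d hd => ?_) (fun u c hu d hd => ?_) hx
  · simp
  · rw [map_add, AddMonoidAlgebra.coeff_add] at hd
    exact (Finset.mem_union.mp (Finsupp.support_add hd)).elim (hx d) (hy d)
  · rw [coxMap_mk_monomial, AddMonoidAlgebra.coeff_single] at hd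
    obtain rfl := Finset.mem_singleton.mp (Finsupp.support_single_subset hd)
    exact ⟨intDiv_nonneg _, by rw [hL.weightOf_incDiv, hu]⟩

variable (L k) in
/-- The ring `⨁_{j ≥ 0} A_{jϑ}`. -/
abbrev SemiInvariantRing : Type _ := semiInvariants (weightGrading L k) (specialWeight D.ℓ)

variable (L k) in
/-- The grading of `⨁_{j ≥ 0} A_{jϑ}`. -/
abbrev semiGrading : ℕ → Submodule k (SemiInvariantRing L k) :=
  semiInvariantsGrading (weightGrading L k) (specialWeight D.ℓ)

variable (L k) in
/-- The homomorphism from `⨁_{j ≥ 0} A_{jϑ}` to the ring of Laurent polynomials in the variables of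
the total coordinate ring. -/
def semiCoxMap : SemiInvariantRing L k →ₐ[k] D.CoxRing k :=
  (coxMap L k).comp (((Polynomial.aeval (1 : ToricRing L k)).restrictScalars k).comp
    (semiInvariants (weightGrading L k) (specialWeight D.ℓ)).val)

lemma eq_monomial_of_mem_semiGrading {n : ℕ} {b : SemiInvariantRing L k}
    (hb : b ∈ semiGrading L k n) : b.1 = Polynomial.monomial n (b.1.coeff n) := by
  ext i
  rw [Polynomial.coeff_monomial]
  split_ifs with h
  · rw [h]
  · exact hb i (Ne.symm h)

lemma semiCoxMap_of_mem {n : ℕ} {b : SemiInvariantRing L k} (hb : b ∈ semiGrading L k n) :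
    semiCoxMap L k b = coxMap L k (b.1.coeff n) := by
  change coxMap L k (Polynomial.aeval (1 : ToricRing L k) b.1) = _
  rw [eq_monomial_of_mem_semiGrading hb, Polynomial.aeval_monomial, one_pow, mul_one,
    Polynomial.coeff_monomial_same]
  rfl

/-- `semiCoxMap` sets the auxiliary variable `T` to `1`, which loses nothing within a single degree.
-/
lemma IsDualCollection.semiCoxMap_injOn (hL : IsDualCollection L) {n : ℕ}
    {b b' : SemiInvariantRing L k} (hb : b ∈ semiGrading L k n) (hb' : b' ∈ semiGrading L k n)
    (h : semiCoxMap L k b = semiCoxMap L k b') : b = b' := by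
  rw [semiCoxMap_of_mem hb, semiCoxMap_of_mem hb'] at h
  refine Subtype.ext ?_
  rw [eq_monomial_of_mem_semiGrading hb, eq_monomial_of_mem_semiGrading hb',
    hL.coxMap_injective h]

lemma IsDualCollection.mem_support_semiCoxMap (hL : IsDualCollection L) {n : ℕ}
    {b : SemiInvariantRing L k} (hb : b ∈ semiGrading L k n) :
    ∀ d ∈ (semiCoxMap L k b).coeff.support, d ∈ D.sectionDivisors n := by
  intro d hd
  rw [semiCoxMap_of_mem hb] at hd
  obtain ⟨h0, h1⟩ := hL.mem_support_coxMap (b.2 n) d hd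
  exact ⟨h0, weightOf_eq_smul_specialWeight_iff.mp h1⟩

lemma IsDualCollection.exists_semiCoxMap_eq_single (hL : IsDualCollection L) {n : ℕ}
    {d : D.Ray → ℤ} (hd : d ∈ D.sectionDivisors n) (c : k) :
    ∃ b ∈ semiGrading L k n, semiCoxMap L k b = AddMonoidAlgebra.single d c := by
  obtain ⟨x, hx, hxd⟩ := hL.exists_coxMap_eq_single (k := k) hd.1
    (fun j => by rw [hd.2]; exact Int.natCast_nonneg n)
  rw [weightOf_eq_smul_specialWeight_iff.mpr hd.2] at hx
  let b : SemiInvariantRing L k := ⟨Polynomial.monomial n (c • x), fun j => by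
    rw [Polynomial.coeff_monomial]
    split_ifs with h
    · rw [← h]; exact Submodule.smul_mem _ _ hx
    · exact Submodule.zero_mem _⟩
  have hb : b ∈ semiGrading L k n := fun i hi => by
    change (Polynomial.monomial n (c • x)).coeff i = 0
    rw [Polynomial.coeff_monomial, if_neg (Ne.symm hi)]
  refine ⟨b, hb, ?_⟩
  rw [semiCoxMap_of_mem hb]
  change coxMap L k ((Polynomial.monomial n (c • x)).coeff n) = _
  rw [Polynomial.coeff_monomial_same, map_smul, hxd, AddMonoidAlgebra.smul_single, smul_eq_mul,
    mul_one]

/-- Homogeneous elements are sums of monomials. -/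
lemma IsDualCollection.semiGrading_induction (hL : IsDualCollection L) {n : ℕ}
    {p : SemiInvariantRing L k → Prop} (h0 : p 0) (hadd : ∀ x y, p x → p y → p (x + y))
    (hmono : ∀ d ∈ D.sectionDivisors n, ∀ (c : k), ∀ b ∈ semiGrading L k n,
      semiCoxMap L k b = AddMonoidAlgebra.single d c → p b)
    {b : SemiInvariantRing L k} (hb : b ∈ semiGrading L k n) : p b := by
  classical
  have hs := hL.mem_support_semiCoxMap hb
  choose! m hm hm' using fun (d : D.Ray → ℤ) (hd : d ∈ (semiCoxMap L k b).coeff.support) =>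
    hL.exists_semiCoxMap_eq_single (hs d hd) ((semiCoxMap L k b).coeff d)
  have e : b = ∑ d ∈ (semiCoxMap L k b).coeff.support, m d := by
    refine hL.semiCoxMap_injOn hb (Submodule.sum_mem _ hm) ?_
    rw [map_sum, Finset.sum_congr rfl hm']
    refine AddMonoidAlgebra.coeff_injective ?_
    rw [AddMonoidAlgebra.coeff_sum]
    exact (Finsupp.sum_single _).symm
  rw [e]
  exact Finset.sum_induction _ p hadd h0 fun d hd => hmono d (hs d hd) _ _ (hm d hd) (hm' d hd)

/-- A section with prescribed divisor. -/
def IsDualCollection.section (hL : IsDualCollection L) (k : Type*) [Field k] {n : ℕ}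
    {d : D.Ray → ℤ} (hd : d ∈ D.sectionDivisors n) : SemiInvariantRing L k :=
  (hL.exists_semiCoxMap_eq_single hd (1 : k)).choose

lemma IsDualCollection.section_mem (hL : IsDualCollection L) {n : ℕ} {d : D.Ray → ℤ}
    (hd : d ∈ D.sectionDivisors n) : hL.section k hd ∈ semiGrading L k n :=
  (hL.exists_semiCoxMap_eq_single hd (1 : k)).choose_spec.1

lemma IsDualCollection.semiCoxMap_section (hL : IsDualCollection L) {n : ℕ} {d : D.Ray → ℤ}
    (hd : d ∈ D.sectionDivisors n) :
    semiCoxMap L k (hL.section k hd) = AddMonoidAlgebra.single d 1 :=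
  (hL.exists_semiCoxMap_eq_single hd (1 : k)).choose_spec.2

/-- The degree and the divisor of the product enter through equations, so that no transport is
needed when they are not syntactically sums. -/
lemma IsDualCollection.section_add (hL : IsDualCollection L) {m n N : ℕ} {d e f : D.Ray → ℤ}
    (hd : d ∈ D.sectionDivisors m) (he : e ∈ D.sectionDivisors n)
    (hf : f ∈ D.sectionDivisors N) (hN : N = m + n) (h : f = d + e) :
    hL.section k hf = hL.section k hd * hL.section k he := by
  subst hN
  refine hL.semiCoxMap_injOn (hL.section_mem hf)
    (SetLike.mul_mem_graded (hL.section_mem hd) (hL.section_mem he)) ?_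
  rw [map_mul, hL.semiCoxMap_section, hL.semiCoxMap_section, hL.semiCoxMap_section,
    AddMonoidAlgebra.single_mul_single, mul_one, h]

/-- The section that is nonzero exactly on the `i`-th maximal chart. -/
def IsDualCollection.vertexSection (hL : IsDualCollection L) (k : Type*) [Field k]
    (i : Fin (D.ℓ + 1)) : SemiInvariantRing L k :=
  hL.section k (vertexDivisor_mem i)

lemma IsDualCollection.exists_eq_mul_vertexSection (hL : IsDualCollection L) {n : ℕ}
    {d : D.Ray → ℤ} (hd : d ∈ D.sectionDivisors (n + 1)) {c : k} {b : SemiInvariantRing L k}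
    (hb : b ∈ semiGrading L k (n + 1))
    (h : semiCoxMap L k b = AddMonoidAlgebra.single d c) :
    ∃ i, ∃ b' ∈ semiGrading L k n, b = b' * hL.vertexSection k i := by
  obtain ⟨i, hi⟩ := exists_sub_vertexDivisor_mem hd
  obtain ⟨b', hb', e⟩ := hL.exists_semiCoxMap_eq_single hi c
  refine ⟨i, b', hb', hL.semiCoxMap_injOn hb
    (SetLike.mul_mem_graded hb' (hL.section_mem (vertexDivisor_mem i))) ?_⟩
  rw [map_mul, h, e, vertexSection, hL.semiCoxMap_section, AddMonoidAlgebra.single_mul_single,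
    mul_one, sub_add_cancel]

/-- The irrelevant ideal is generated by the sections of the maximal charts. -/
lemma IsDualCollection.irrelevant_le_span (hL : IsDualCollection L) :
    (HomogeneousIdeal.irrelevant (semiGrading L k)).toIdeal ≤
      Ideal.span (Set.range (hL.vertexSection k)) := by
  refine (HomogeneousIdeal.toIdeal_irrelevant_le _).mpr fun n hn b hb => ?_
  obtain ⟨n, rfl⟩ : ∃ m, n = m + 1 := ⟨n - 1, by omega⟩
  refine hL.semiGrading_induction (p := fun b => b ∈ Ideal.span (Set.range (hL.vertexSection k)))
    (zero_mem _) (fun x y => add_mem) (fun d hd c b hb h => ?_) hb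
  obtain ⟨i, b', -, rfl⟩ := hL.exists_eq_mul_vertexSection hd hb h
  exact Ideal.mul_mem_left _ _ (Ideal.subset_span ⟨i, rfl⟩)

variable (L k) in
/-- The inclusion of `A_0` into `⨁_{j ≥ 0} A_{jϑ}`. -/
def zeroToSemi : weightGrading L k 0 →+* SemiInvariantRing L k where
  toFun x := (toSemiInvariantsZero (weightGrading L k) (specialWeight D.ℓ) x).1
  map_one' := congrArg Subtype.val (RingHom.map_one _)
  map_zero' := congrArg Subtype.val (RingHom.map_zero _)
  map_add' x y := congrArg Subtype.val (RingHom.map_add _ x y)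
  map_mul' x y := congrArg Subtype.val (RingHom.map_mul _ x y)

lemma zeroToSemi_mem (x : weightGrading L k 0) : zeroToSemi L k x ∈ semiGrading L k 0 :=
  (toSemiInvariantsZero (weightGrading L k) (specialWeight D.ℓ) x).2

lemma exists_zeroToSemi_eq {b : SemiInvariantRing L k} (hb : b ∈ semiGrading L k 0) :
    ∃ x, zeroToSemi L k x = b := by
  refine ⟨⟨b.1.coeff 0, ?_⟩, Subtype.ext ?_⟩
  · have := b.2 0
    rwa [zero_smul] at this
  · exact Polynomial.monomial_zero_left.symm.trans (eq_monomial_of_mem_semiGrading hb).symm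

lemma semiCoxMap_zeroToSemi (x : weightGrading L k 0) :
    semiCoxMap L k (zeroToSemi L k x) = coxMap L k x.1 := by
  rw [semiCoxMap_of_mem (zeroToSemi_mem x)]
  change coxMap L k ((Polynomial.C x.1).coeff 0) = _
  rw [Polynomial.coeff_C_zero]

lemma toSemiInvariantsZero_surjective :
    Function.Surjective (toSemiInvariantsZero (weightGrading L k) (specialWeight D.ℓ)) := by
  intro b
  obtain ⟨x, hx⟩ := exists_zeroToSemi_eq b.2
  exact ⟨x, Subtype.ext hx⟩

/-- The morphism obtained by variation of GIT quotient is projective. -/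
theorem IsDualCollection.isProjectiveMorphism (hL : IsDualCollection L) :
    IsProjectiveMorphism (R := weightGrading L k 0) (toricVariation L k) := by
  refine isProjectiveMorphism_toSpecZero (ℬ := semiGrading L k)
    (toSemiInvariantsZero (weightGrading L k) (specialWeight D.ℓ)) (hL.vertexSection k)
    (fun i => hL.section_mem (vertexDivisor_mem i)) toSemiInvariantsZero_surjective
    fun m b hb => ?_
  refine hL.semiGrading_induction (p := fun b => b ∈ AddSubgroup.closure
    {b' * hL.vertexSection k i | (b' ∈ semiGrading L k m) (i)}) (zero_mem _)
    (fun x y => add_mem) (fun d hd c b hb h => ?_) hb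
  obtain ⟨i, b', hb', rfl⟩ := hL.exists_eq_mul_vertexSection hd hb h
  exact AddSubgroup.subset_closure ⟨b', hb', i, rfl⟩

end CyclicQuotientType

/-! ### Affine charts of the fan as basic opens of `Proj`. -/

namespace CyclicQuotientType

variable {D : CyclicQuotientType} {L : Fin (D.ℓ + 1) → D.Pic} {k : Type*} [Field k]

open HomogeneousLocalization

variable (D k) in
/-- The inclusion of the coordinate ring of a chart into the ring of Laurent polynomials in the
variables of the total coordinate ring, sending a character to its divisor. -/
def chartToCox (s : Finset D.Ray) : D.ChartRing k s →ₐ[k] D.CoxRing k :=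
  AddMonoidAlgebra.mapDomainAlgHom k k (D.charDivHom.comp
    ((D.dualSemigroup s).subtype.codRestrict D.latticeM fun m => m.2.1))

lemma chartToCox_single (s : Finset D.Ray) (m : D.dualSemigroup s) (c : k) :
    chartToCox D k s (AddMonoidAlgebra.single m c) =
      AddMonoidAlgebra.single (D.charDivHom ⟨m.1, m.2.1⟩) c := by
  simp [chartToCox]
  rfl

lemma chartToCox_injective (s : Finset D.Ray) : Function.Injective (chartToCox D k s) := by
  refine AddMonoidAlgebra.mapDomain_injective fun m n h => Subtype.ext ?_
  exact congrArg (fun x : D.latticeM => x.1) (D.charDivHom_injective h)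

lemma chartToCox_chartMap {s t : Finset D.Ray} (h : s ⊆ t) (z : D.ChartRing k t) :
    chartToCox D k s (D.chartMap k h z) = chartToCox D k t z := by
  induction z using AddMonoidAlgebra.induction_linear with
  | zero => simp
  | add p q hp hq => simp only [map_add, hp, hq]
  | single m x => rw [chartMap_single, chartToCox_single, chartToCox_single]; rfl

lemma IsDualCollection.semiCoxMap_section_mul (hL : IsDualCollection L) {n : ℕ} {d : D.Ray → ℤ}
    (hd : d ∈ D.sectionDivisors n) :
    (semiCoxMap L k).toRingHom (hL.section k hd) * AddMonoidAlgebra.single (-d) 1 = 1 := by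
  change semiCoxMap L k _ * _ = _
  rw [hL.semiCoxMap_section, AddMonoidAlgebra.single_mul_single, add_neg_cancel, one_mul]
  rfl

/-- The inclusion of the coordinate ring of the complement of a section into the ring of Laurent
polynomials in the variables of the total coordinate ring. -/
def IsDualCollection.awayToCox (hL : IsDualCollection L) (k : Type*) [Field k] {n : ℕ}
    {d : D.Ray → ℤ} (hd : d ∈ D.sectionDivisors n) :
    Away (semiGrading L k) (hL.section k hd) →+* D.CoxRing k :=
  (Localization.awayLift (semiCoxMap L k).toRingHom (hL.section k hd)
    (isUnit_iff_exists_inv.mpr ⟨_, hL.semiCoxMap_section_mul hd⟩)).comp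
    (algebraMap (Away (semiGrading L k) (hL.section k hd)) (Localization.Away (hL.section k hd)))

lemma IsDualCollection.awayToCox_mk (hL : IsDualCollection L) {n : ℕ} {d : D.Ray → ℤ}
    (hd : d ∈ D.sectionDivisors n) (i : ℕ) (b : SemiInvariantRing L k)
    (hb : b ∈ semiGrading L k (i • n)) :
    hL.awayToCox k hd (Away.mk _ (hL.section_mem hd) i b hb) =
      semiCoxMap L k b * AddMonoidAlgebra.single (-(i • d)) 1 := by
  refine (Localization.awayLift_mk (semiCoxMap L k).toRingHom _ b _
    (hL.semiCoxMap_section_mul hd) i).trans ?_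
  rw [AddMonoidAlgebra.single_pow, one_pow, smul_neg]
  rfl

/-- The denominator becomes an invertible monomial, and the numerator is homogeneous, where
`semiCoxMap` is injective. -/
lemma IsDualCollection.awayToCox_injective (hL : IsDualCollection L) {n : ℕ} {d : D.Ray → ℤ}
    (hd : d ∈ D.sectionDivisors n) : Function.Injective (hL.awayToCox k hd) := by
  refine (injective_iff_map_eq_zero _).mpr fun x hx => ?_
  obtain ⟨i, b, hb, rfl⟩ := Away.mk_surjective _ (hL.section_mem hd) x
  rw [hL.awayToCox_mk] at hx
  have h : semiCoxMap L k b = 0 := by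
    have := congrArg (· * AddMonoidAlgebra.single (i • d) 1) hx
    rwa [mul_assoc, AddMonoidAlgebra.single_mul_single, neg_add_cancel, one_mul,
      ← AddMonoidAlgebra.one_def, mul_one, zero_mul] at this
  have hb0 : b = 0 := hL.semiCoxMap_injOn hb (zero_mem _) (by rw [h, map_zero])
  exact mk_eq_zero_of_num _ (Subtype.ext hb0)

lemma IsDualCollection.awayToCox_awayMap (hL : IsDualCollection L) {m n N : ℕ}
    {d e f : D.Ray → ℤ} (hd : d ∈ D.sectionDivisors m) (he : e ∈ D.sectionDivisors n)
    (hf : f ∈ D.sectionDivisors N) (hN : N = m + n) (h : f = d + e)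
    (x : Away (semiGrading L k) (hL.section k hd)) :
    hL.awayToCox k hf (awayMap _ (hL.section_mem he) (hL.section_add hd he hf hN h) x) =
      hL.awayToCox k hd x := by
  subst hN
  obtain ⟨i, b, hb, rfl⟩ := Away.mk_surjective _ (hL.section_mem hd) x
  rw [awayMap_mk, hL.awayToCox_mk, hL.awayToCox_mk, map_mul, map_pow, hL.semiCoxMap_section,
    AddMonoidAlgebra.single_pow, mul_assoc, AddMonoidAlgebra.single_mul_single, h]
  simp

/-- Numerator and denominator are sections of the same bundle, so each monomial of the quotient is a
character. It has no pole along the rays of `s`, because `d` vanishes there. -/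
lemma IsDualCollection.awayToCox_mem_range (hL : IsDualCollection L) {n : ℕ} {d : D.Ray → ℤ}
    (hd : d ∈ D.sectionDivisors n) (s : Finset D.Ray) (hs : ∀ ρ ∈ s, d ρ = 0)
    (x : Away (semiGrading L k) (hL.section k hd)) :
    hL.awayToCox k hd x ∈ (chartToCox D k s).range := by
  obtain ⟨i, b, hb, rfl⟩ := Away.mk_surjective _ (hL.section_mem hd) x
  rw [hL.awayToCox_mk]
  refine hL.semiGrading_induction (p := fun b => semiCoxMap L k b *
    AddMonoidAlgebra.single (-(i • d)) 1 ∈ (chartToCox D k s).range) ?_ (fun x y hx hy => ?_)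
    (fun e he c b _ h => ?_) hb
  · rw [map_zero, zero_mul]
    exact zero_mem _
  · rw [map_add, add_mul]
    exact add_mem hx hy
  · obtain ⟨m, hm⟩ := D.exists_charDivHom_of_divDeg_eq_zero (d := e + -(i • d)) (by
      funext j
      rw [map_add, map_neg, map_nsmul, Pi.add_apply, Pi.neg_apply, Pi.smul_apply, he.2, hd.2]
      simp)
    refine ⟨AddMonoidAlgebra.single ⟨m.1, m.2, fun ρ hρ => ?_⟩ c, ?_⟩
    · rw [← charDivHom_nonneg_iff, hm, Pi.add_apply, Pi.neg_apply, Pi.smul_apply, hs ρ hρ]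
      simpa using he.1 ρ
    · change chartToCox D k s _ = _
      rw [chartToCox_single, h, AddMonoidAlgebra.single_mul_single, mul_one, hm]

/-- Conversely, the poles of a character regular on the chart of `s` lie along rays where `d` is
positive, so a power of the section clears them. -/
lemma IsDualCollection.exists_awayToCox_eq (hL : IsDualCollection L) {n : ℕ} {d : D.Ray → ℤ}
    (hd : d ∈ D.sectionDivisors n) (s : Finset D.Ray) (hs : ∀ ρ, d ρ = 0 → ρ ∈ s)
    (z : D.ChartRing k s) : ∃ x, hL.awayToCox k hd x = chartToCox D k s z := by
  induction z using AddMonoidAlgebra.induction_linear with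
  | zero => exact ⟨0, by rw [map_zero, map_zero]⟩
  | add p q hp hq =>
    obtain ⟨x, hx⟩ := hp
    obtain ⟨y, hy⟩ := hq
    exact ⟨x + y, by rw [map_add, map_add, hx, hy]⟩
  | single m c =>
    obtain ⟨i, hi⟩ := exists_nsmul_add_nonneg (c := D.charDivHom ⟨m.1, m.2.1⟩) hd.1 hs
      fun ρ hρ => (D.charDivHom_nonneg_iff _ _).mpr (m.2.2 ρ hρ)
    obtain ⟨b, hb, hb'⟩ := hL.exists_semiCoxMap_eq_single (k := k) (n := i • n) ⟨hi, fun j => by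
      rw [map_add, divDeg_charDivHom, zero_add]
      exact (nsmul_mem_sectionDivisors hd i).2 j⟩ c
    refine ⟨Away.mk _ (hL.section_mem hd) i b hb, ?_⟩
    rw [hL.awayToCox_mk, hb', chartToCox_single, AddMonoidAlgebra.single_mul_single, mul_one,
      add_neg_cancel_right]

/-- The section whose zero locus is the complement of the chart of a cone. -/
abbrev IsDualCollection.coneSection (hL : IsDualCollection L) (k : Type*) [Field k] (s : D.Fan) :
    SemiInvariantRing L k :=
  hL.section k (coneDivisor_mem s)

/-- The homomorphism from the coordinate ring of the complement of a section to that of a chart. -/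
def IsDualCollection.awayToChart (hL : IsDualCollection L) (k : Type*) [Field k] (s : D.Fan) :
    Away (semiGrading L k) (hL.coneSection k s) →+* D.ChartRing k s.1 :=
  (AlgEquiv.ofInjective (chartToCox D k s.1)
    (chartToCox_injective s.1)).symm.toAlgHom.toRingHom.comp
    ((hL.awayToCox k (coneDivisor_mem s)).codRestrict (chartToCox D k s.1).range
      (hL.awayToCox_mem_range (coneDivisor_mem s) s.1
        fun ρ => (coneDivisor_eq_zero_iff s ρ).mpr))

lemma IsDualCollection.chartToCox_awayToChart (hL : IsDualCollection L) (s : D.Fan)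
    (x : Away (semiGrading L k) (hL.coneSection k s)) :
    chartToCox D k s.1 (hL.awayToChart k s x) = hL.awayToCox k (coneDivisor_mem s) x :=
  congrArg Subtype.val ((AlgEquiv.ofInjective (chartToCox D k s.1)
    (chartToCox_injective s.1)).apply_symm_apply ⟨hL.awayToCox k (coneDivisor_mem s) x, _⟩)

lemma IsDualCollection.awayToChart_bijective (hL : IsDualCollection L) (s : D.Fan) :
    Function.Bijective (hL.awayToChart k s) := by
  refine ⟨fun x y h => hL.awayToCox_injective (coneDivisor_mem s) ?_, fun z => ?_⟩
  · rw [← hL.chartToCox_awayToChart, ← hL.chartToCox_awayToChart, h]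
  · obtain ⟨x, hx⟩ := hL.exists_awayToCox_eq (coneDivisor_mem s) s.1
      (fun ρ => (coneDivisor_eq_zero_iff s ρ).mp) z
    exact ⟨x, chartToCox_injective s.1 (by rw [hL.chartToCox_awayToChart, hx])⟩

instance (hL : IsDualCollection L) (s : D.Fan) :
    IsIso (CommRingCat.ofHom (hL.awayToChart k s)) :=
  (RingEquiv.ofBijective _ (hL.awayToChart_bijective s)).toCommRingCatIso.isIso_hom

/-- The open immersion of a chart of the toric surface into the GIT quotient. -/
def IsDualCollection.chartToGIT (hL : IsDualCollection L) (k : Type*) [Field k] (s : D.Fan) :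
    (D.chartFunctor k).obj s ⟶ toricGIT L k :=
  Spec.map (CommRingCat.ofHom (hL.awayToChart k s)) ≫
    Proj.awayι (semiGrading L k) (hL.coneSection k s) (hL.section_mem _) (coneDegree_pos s)

instance (hL : IsDualCollection L) (s : D.Fan) : IsOpenImmersion (hL.chartToGIT k s) := by
  unfold IsDualCollection.chartToGIT
  have : IsIso (Spec.map (CommRingCat.ofHom (hL.awayToChart k s))) := inferInstance
  have : IsOpenImmersion (Spec.map (CommRingCat.ofHom (hL.awayToChart k s))) :=
    IsOpenImmersion.of_isIso _
  have h : IsOpenImmersion (Proj.awayι (semiGrading L k) (hL.coneSection k s)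
    (hL.section_mem (coneDivisor_mem s)) (coneDegree_pos s)) := inferInstance
  exact @IsOpenImmersion.comp _ _ _ _ _ this h

/-- The section of `t` divides that of its face `s`, so the further localisation exists; it agrees
with the inclusion of semigroup rings because both become inclusions in the Cox ring. -/
lemma IsDualCollection.chartFunctor_map_chartToGIT (hL : IsDualCollection L) {s t : D.Fan}
    (h : s ⟶ t) : (D.chartFunctor k).map h ≫ hL.chartToGIT k t = hL.chartToGIT k s := by
  obtain ⟨n, hn, d, hd, e⟩ := exists_coneDivisor_eq_add (leOfHom h)
  have he := Proj.SpecMap_awayMap_awayι (semiGrading L k) (hL.section_mem (coneDivisor_mem t))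
    (coneDegree_pos t) (hL.section_mem hd)
    (hL.section_add (coneDivisor_mem t) hd (coneDivisor_mem s) hn e)
  change Spec.map _ ≫ Spec.map _ ≫ _ = Spec.map _ ≫ Proj.awayι _ _ _ _
  rw [← Category.assoc, ← Spec.map_comp]
  refine Eq.trans ?_ (congrArg _ he)
  rw [← Category.assoc, ← Spec.map_comp]
  congr 2
  refine CommRingCat.hom_ext (RingHom.ext fun x => chartToCox_injective s.1 ?_)
  change chartToCox D k s.1 (D.chartMap k (leOfHom h) (hL.awayToChart k t x)) =
    chartToCox D k s.1 (hL.awayToChart k s (awayMap _ (hL.section_mem hd)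
      (hL.section_add (coneDivisor_mem t) hd (coneDivisor_mem s) hn e) x))
  rw [chartToCox_chartMap, hL.chartToCox_awayToChart, hL.chartToCox_awayToChart,
    hL.awayToCox_awayMap _ _ _ hn e]

end CyclicQuotientType

/-! ### The isomorphism of the toric surface with the GIT quotient. -/

namespace CyclicQuotientType

variable {D : CyclicQuotientType} {L : Fin (D.ℓ + 1) → D.Pic} {k : Type*} [Field k]

/-- The charts of the toric surface as open subschemes of the GIT quotient. -/
def IsDualCollection.chartCocone (hL : IsDualCollection L) (k : Type*) [Field k] :
    Cocone (D.chartFunctor k) where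
  pt := toricGIT L k
  ι :=
    { app := hL.chartToGIT k
      naturality := fun _ _ h =>
        (hL.chartFunctor_map_chartToGIT h).trans (Category.comp_id _).symm }

lemma IsDualCollection.opensRange_chartToGIT (hL : IsDualCollection L) (s : D.Fan) :
    (hL.chartToGIT k s).opensRange = Proj.basicOpen (semiGrading L k) (hL.coneSection k s) := by
  have h0 : IsIso (Spec.map (CommRingCat.ofHom (hL.awayToChart k s))) := inferInstance
  have h : IsOpenImmersion (Proj.awayι (semiGrading L k) (hL.coneSection k s)
    (hL.section_mem (coneDivisor_mem s)) (coneDegree_pos s)) := inferInstance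
  have h1 := @Scheme.Hom.opensRange_comp_of_isIso _ _ _
    (Spec.map (CommRingCat.ofHom (hL.awayToChart k s)))
    (Proj.awayι (semiGrading L k) (hL.coneSection k s)
      (hL.section_mem (coneDivisor_mem s)) (coneDegree_pos s)) h0 h
  have h2 := Proj.opensRange_awayι (semiGrading L k) (hL.coneSection k s)
    (hL.section_mem (coneDivisor_mem s)) (coneDegree_pos s)
  exact h1.trans h2

lemma IsDualCollection.exists_chartToGIT_eq_iff (hL : IsDualCollection L) (s : D.Fan)
    (x : toricGIT L k) : (∃ y, hL.chartToGIT k s y = x) ↔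
      x ∈ Proj.basicOpen (semiGrading L k) (hL.coneSection k s) := by
  rw [← hL.opensRange_chartToGIT]
  rfl

/-- If the support of `e` lies in that of `d`, a large multiple of `d` dominates `e`, so the section
of `e` divides a power of the section of `d`. -/
lemma IsDualCollection.basicOpen_section_le (hL : IsDualCollection L) {m n : ℕ} (hm : 0 < m)
    {d e : D.Ray → ℤ} (hd : d ∈ D.sectionDivisors m) (he : e ∈ D.sectionDivisors n)
    (h : ∀ ρ, d ρ = 0 → e ρ = 0) :
    Proj.basicOpen (semiGrading L k) (hL.section k hd) ≤
      Proj.basicOpen (semiGrading L k) (hL.section k he) := by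
  classical
  obtain ⟨N, hN⟩ := exists_nsmul_add_nonneg (s := {ρ | d ρ = 0}) (c := -e) hd.1
    (fun ρ hρ => by simpa using hρ) (fun ρ hρ => by
      have := h ρ (by simpa using hρ)
      simp [this])
  -- `N` makes the difference effective; the summand `n + 1` ensures `n ≤ K * m`, so the subtraction
  -- of degrees is not truncated, and `K ≠ 0`.
  let K := N + n + 1
  have hK : 0 ≤ K • d - e := by
    have e1 : K • d - e = (-e + N • d) + (n + 1) • d := by
      simp only [K, add_assoc, add_smul]
      abel
    rw [e1]
    exact add_nonneg hN (nsmul_nonneg hd.1 _)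
  have hle : n ≤ K * m := by
    have : K * 1 ≤ K * m := Nat.mul_le_mul_left _ hm
    omega
  have hf : K • d - e ∈ D.sectionDivisors (K * m - n) := by
    refine ⟨hK, fun j => ?_⟩
    rw [map_sub, Pi.sub_apply, (nsmul_mem_sectionDivisors hd K).2, he.2]
    push_cast [hle]
    rfl
  have key : hL.section k hd ^ K = hL.section k he * hL.section k hf := by
    have h1 : hL.section k he * hL.section k hf ∈ semiGrading L k (n + (K * m - n)) :=
      SetLike.mul_mem_graded (hL.section_mem he) (hL.section_mem hf)
    rw [Nat.add_sub_cancel' hle] at h1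
    refine hL.semiCoxMap_injOn (SetLike.pow_mem_graded K (hL.section_mem hd)) h1 ?_
    rw [map_pow, map_mul, hL.semiCoxMap_section, hL.semiCoxMap_section, hL.semiCoxMap_section,
      AddMonoidAlgebra.single_pow, AddMonoidAlgebra.single_mul_single, add_sub_cancel, one_pow,
      one_mul]
  rw [← Proj.basicOpen_pow (semiGrading L k) (hL.section k hd) K (by omega), key]
  exact Proj.basicOpen_mono _ _ _ (dvd_mul_right _ _)

/-- The morphism from the toric surface to the GIT quotient. -/
def IsDualCollection.toGIT (hL : IsDualCollection L) (k : Type*) [Field k] :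
    D.toricSurface k ⟶ toricGIT L k :=
  colimit.desc (D.chartFunctor k) (hL.chartCocone k)

/-- The GIT quotient is isomorphic to the toric surface. -/
instance IsDualCollection.isIso_toGIT (hL : IsDualCollection L) : IsIso (hL.toGIT k) := by
  have : ∀ s, IsOpenImmersion ((hL.chartCocone k).ι.app s) := fun s =>
    inferInstanceAs (IsOpenImmersion (hL.chartToGIT k s))
  refine Scheme.isIso_colimit_desc (D.chartFunctor k) (hL.chartCocone k) (fun x => ?_)
    fun s t x y hxy => ?_
  -- The charts of the maximal cones already cover `Proj`.
  · have htop := Proj.iSup_basicOpen_eq_top (semiGrading L k) (hL.vertexSection k)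
      hL.irrelevant_le_span
    have hx : x ∈ ⨆ i, Proj.basicOpen (semiGrading L k) (hL.vertexSection k i) := by
      rw [htop]
      trivial
    obtain ⟨i, hi⟩ := TopologicalSpace.Opens.mem_iSup.mp hx
    let s : D.Fan := ⟨{i.castSucc, i.succ}, i, subset_rfl⟩
    refine ⟨s, (hL.exists_chartToGIT_eq_iff s x).mpr ?_⟩
    refine hL.basicOpen_section_le one_pos (vertexDivisor_mem i) (coneDivisor_mem s)
      (fun ρ hρ => ?_) hi
    exact (coneDivisor_eq_zero_iff s ρ).mpr ((vertexDivisor_eq_zero_iff i ρ).mp hρ)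
  · let l : D.Fan := ⟨s.1 ∩ t.1, by
      obtain ⟨i, hi⟩ := s.2
      exact ⟨i, Finset.inter_subset_left.trans hi⟩⟩
    refine ⟨l, homOfLE (Finset.inter_subset_left : s.1 ∩ t.1 ⊆ s.1),
      homOfLE (Finset.inter_subset_right : s.1 ∩ t.1 ⊆ t.1),
      (hL.exists_chartToGIT_eq_iff l _).mpr ?_⟩
    have hs := (hL.exists_chartToGIT_eq_iff s (hL.chartToGIT k s x)).mp ⟨x, rfl⟩
    have ht := (hL.exists_chartToGIT_eq_iff t (hL.chartToGIT k s x)).mp ⟨y, hxy.symm⟩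
    -- The product of the two sections vanishes off exactly the common rays, so the two charts meet
    -- in the chart of the common face.
    have hst := add_mem_sectionDivisors (coneDivisor_mem s) (coneDivisor_mem t)
    refine hL.basicOpen_section_le (Nat.add_pos_left (coneDegree_pos s) _) hst
      (coneDivisor_mem l) (fun ρ hρ => ?_) ?_
    · have h1 : 0 ≤ coneDivisor s ρ := (coneDivisor_mem s).1 ρ
      have h2 : 0 ≤ coneDivisor t ρ := (coneDivisor_mem t).1 ρ
      rw [Pi.add_apply] at hρ
      exact (coneDivisor_eq_zero_iff l ρ).mpr (Finset.mem_inter.mpr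
        ⟨(coneDivisor_eq_zero_iff s ρ).mp (by omega), (coneDivisor_eq_zero_iff t ρ).mp (by omega)⟩)
    · rw [hL.section_add (coneDivisor_mem s) (coneDivisor_mem t) hst rfl rfl,
        Proj.basicOpen_mul]
      exact ⟨hs, ht⟩

end CyclicQuotientType

/-! ### The ring of invariants and compatibility with the resolution. -/

namespace CyclicQuotientType

variable {D : CyclicQuotientType} {L : Fin (D.ℓ + 1) → D.Pic} {k : Type*} [Field k]

variable (D k) in
/-- The monomial of the plane attached to an effective divisor, as a homomorphism. -/
def planeHom : Multiplicative (D.Ray → ℕ) →* MvPolynomial (Fin 2) k where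
  toFun d := D.planeMonomial k d.toAdd
  map_one' := by simp [planeMonomial]
  map_mul' d e := by
    simp only [planeMonomial, toAdd_mul, Pi.add_apply, pow_add]
    ring

variable (L k) in
/-- The homomorphism from the coordinate ring of `𝕍(I_Q)` to the coordinate ring of the plane. -/
def planeMap : ToricRing L k →ₐ[k] MvPolynomial (Fin 2) k :=
  Ideal.Quotient.liftₐ (toricIdeal L k) _ (aeval_label_eq_zero (planeHom D k))

lemma planeMap_mk (P : MvPolynomial (Arrow L) k) :
    planeMap L k (Ideal.Quotient.mk _ P) =
      MvPolynomial.aeval (fun b : Arrow L => D.planeMonomial k b.label) P := rfl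

lemma planeMap_mk_monomial (u : Arrow L →₀ ℕ) (c : k) :
    planeMap L k (Ideal.Quotient.mk _ (MvPolynomial.monomial u c)) =
      c • D.planeMonomial k (incDiv L u).2 :=
  aeval_label_monomial (planeHom D k) u c

lemma planeMonomial_eq (d : D.Ray → ℕ) (c : k) :
    c • D.planeMonomial k d =
      MvPolynomial.monomial (Finsupp.single 0 (d (Fin.last _)) + Finsupp.single 1 (d 0)) c := by
  rw [planeMonomial, MvPolynomial.X_pow_eq_monomial, MvPolynomial.X_pow_eq_monomial,
    MvPolynomial.monomial_mul, MvPolynomial.smul_monomial, smul_eq_mul, mul_one, mul_one]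

variable (D k) in
/-- The projection of the torus of the total coordinate ring to the torus of the plane. -/
def coxToLaurent : D.CoxRing k →ₐ[k] AddMonoidAlgebra k (ℤ × ℤ) :=
  AddMonoidAlgebra.mapDomainAlgHom k k
    ((Pi.evalAddMonoidHom (fun _ : D.Ray => ℤ) (Fin.last _)).prod
      (Pi.evalAddMonoidHom (fun _ : D.Ray => ℤ) 0))

lemma coxToLaurent_single (d : D.Ray → ℤ) (c : k) :
    coxToLaurent D k (AddMonoidAlgebra.single d c) =
      AddMonoidAlgebra.single (d (Fin.last _), d 0) c := by
  simp [coxToLaurent]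

lemma toLaurent_planeMap (x : ToricRing L k) :
    toLaurent (planeMap L k x) = coxToLaurent D k (coxMap L k x) := by
  obtain ⟨P, rfl⟩ := Ideal.Quotient.mk_surjective x
  induction P using MvPolynomial.induction_on' with
  | monomial u c =>
    rw [planeMap_mk_monomial, coxMap_mk_monomial, coxToLaurent_single, planeMonomial_eq,
      toLaurent_monomial]
    simp [intDiv_apply]
  | add p q hp hq => simp only [map_add, hp, hq]

/-- The multiplicities of a character along the two non-exceptional divisors are its exponents in
`x` and `y`. -/
lemma coxToLaurent_chartToCox (s : Finset D.Ray) (z : D.ChartRing k s) :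
    coxToLaurent D k (chartToCox D k s z) = D.chartToLaurent s z := by
  induction z using AddMonoidAlgebra.induction_linear with
  | zero => simp
  | add p q hp hq => simp only [map_add, hp, hq]
  | single m c =>
    rw [chartToCox_single, coxToLaurent_single, chartToLaurent_single, charDivHom_last,
      charDivHom_zero_ray]

lemma IsDualCollection.exists_charDivHom_eq (hL : IsDualCollection L) {u : Arrow L →₀ ℕ}
    (hu : (incDiv L u).1 = 0) : ∃ m : D.latticeM, D.charDivHom m = intDiv (incDiv L u).2 := by
  refine D.exists_charDivHom_of_divDeg_eq_zero (funext fun j => ?_)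
  rw [← hL.weightOf_incDiv, weightOf_eq_iff _ (by simp)] at hu
  exact hu j

lemma IsDualCollection.exists_chartToCox_eq (hL : IsDualCollection L) {x : ToricRing L k}
    (hx : x ∈ weightGrading L k 0) (s : Finset D.Ray) :
    ∃ z, chartToCox D k s z = coxMap L k x := by
  refine weightGrading_induction (p := fun x => ∃ z, chartToCox D k s z = coxMap L k x)
    ⟨0, by rw [map_zero, map_zero]⟩ ?_ (fun u c hu => ?_) hx
  · rintro x y ⟨z, hz⟩ ⟨w, hw⟩
    exact ⟨z + w, by rw [map_add, map_add, hz, hw]⟩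
  · obtain ⟨m, hm⟩ := hL.exists_charDivHom_eq hu
    refine ⟨AddMonoidAlgebra.single ⟨m.1, m.2, fun ρ _ => ?_⟩ c, ?_⟩
    · rw [← charDivHom_nonneg_iff, hm]
      exact intDiv_nonneg _ ρ
    · rw [chartToCox_single, coxMap_mk_monomial]
      exact congrArg (fun d => AddMonoidAlgebra.single d c) hm

/-- The homomorphism `t ↦ diag(t, t ^ a)`. -/
def diagonalHom (k : Type*) [Field k] (a : ℕ) : kˣ →* Matrix.GeneralLinearGroup (Fin 2) k :=
  MonoidHom.toHomUnits
    { toFun := fun t => Matrix.diagonal ![(t : k), (t : k) ^ a]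
      map_one' := by
        rw [← Matrix.diagonal_one]
        congr 1
        ext i
        fin_cases i <;> simp
      map_mul' := fun t u => by
        rw [Matrix.diagonal_mul_diagonal]
        congr 1
        ext i
        fin_cases i <;> simp [mul_pow] }

lemma coe_diagonalHom (a : ℕ) (t : kˣ) :
    (diagonalHom k a t : Matrix (Fin 2) (Fin 2) k) = Matrix.diagonal ![(t : k), (t : k) ^ a] :=
  rfl

/-- Writing the generator as the value of a homomorphism makes every power of it visibly diagonal,
with entries given by a power of `ω`. -/
lemma group_eq (D : CyclicQuotientType) (ω : kˣ) :
    D.group ω = Subgroup.zpowers (diagonalHom k D.a ω) :=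
  congrArg Subgroup.zpowers (Units.ext rfl)

lemma planeMonomial_mem_invariantRing {ω : kˣ} (hω : IsPrimitiveRoot ω D.r) {d : D.Ray → ℕ}
    (hd : (D.r : ℤ) ∣ d (Fin.last _) + D.a * d 0) :
    D.planeMonomial k d ∈ invariantRing (D.group ω) := by
  intro g hg
  rw [group_eq] at hg
  obtain ⟨n, rfl⟩ := hg
  have hpow : (ω ^ n : kˣ) ^ (d (Fin.last _) + D.a * d 0) = 1 := by
    rw [← zpow_natCast, ← zpow_mul, mul_comm, zpow_mul, (hω.zpow_eq_one_iff_dvd _).mpr, one_zpow]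
    exact_mod_cast hd
  have hpow' : ((ω ^ n : kˣ) : k) ^ (d (Fin.last _) + D.a * d 0) = 1 := by
    rw [← Units.val_pow_eq_pow_val, hpow, Units.val_one]
  simp only [← map_zpow]
  rw [coe_diagonalHom]
  generalize ((ω ^ n : kˣ) : k) = t at hpow'
  simp only [planeMonomial, map_mul, map_pow, MvPolynomial.aeval_X, Fin.sum_univ_two,
    Matrix.diagonal_apply]
  simp only [Fin.isValue, if_true, zero_ne_one, one_ne_zero, if_false, map_zero, zero_mul,
    add_zero, zero_add, Matrix.cons_val_zero, Matrix.cons_val_one, mul_pow, ← map_pow, ← pow_mul]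
  rw [mul_mul_mul_comm, ← map_mul, ← pow_add, hpow', map_one, one_mul]

/-- The homomorphism from `A_0` to the ring of invariants. -/
def IsDualCollection.toInvariants (hL : IsDualCollection L) {ω : kˣ} (hω : IsPrimitiveRoot ω D.r) :
    weightGrading L k 0 →ₐ[k] invariantRing (D.group ω) where
  toFun x := ⟨planeMap L k x.1, weightGrading_induction
    (p := fun x => planeMap L k x ∈ invariantRing (D.group ω))
    (by rw [map_zero]; exact zero_mem _) (fun x y hx hy => by rw [map_add]; exact add_mem hx hy)
    (fun u c hu => by
      obtain ⟨m, hm⟩ := hL.exists_charDivHom_eq hu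
      rw [planeMap_mk_monomial]
      refine Subalgebra.smul_mem _ (planeMonomial_mem_invariantRing hω ?_) c
      rw [← intDiv_apply, ← intDiv_apply, ← hm, charDivHom_last, charDivHom_zero_ray]
      exact m.2) x.2⟩
  map_one' := Subtype.ext (map_one (planeMap L k))
  map_zero' := Subtype.ext (map_zero (planeMap L k))
  map_add' x y := Subtype.ext (map_add (planeMap L k) x.1 y.1)
  map_mul' x y := Subtype.ext (map_mul (planeMap L k) x.1 y.1)
  commutes' c := Subtype.ext ((planeMap L k).commutes c)

/-- Weight zero leaves only divisors of characters, and these are not confused when the exceptional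
variables are set to `1`. The empty cone serves as a chart because it is the whole torus. -/
lemma IsDualCollection.toInvariants_injective (hL : IsDualCollection L) {ω : kˣ}
    (hω : IsPrimitiveRoot ω D.r) : Function.Injective (hL.toInvariants hω) := by
  intro x y h
  have h1 : planeMap L k x.1 = planeMap L k y.1 := congrArg Subtype.val h
  obtain ⟨z, hz⟩ := hL.exists_chartToCox_eq x.2 ∅
  obtain ⟨w, hw⟩ := hL.exists_chartToCox_eq y.2 ∅
  have h2 := congrArg toLaurent h1
  rw [toLaurent_planeMap, toLaurent_planeMap, ← hz, ← hw, coxToLaurent_chartToCox,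
    coxToLaurent_chartToCox] at h2
  refine Subtype.ext (hL.coxMap_injective ?_)
  rw [← hz, ← hw, D.chartToLaurent_injective ∅ h2]

lemma IsDualCollection.exists_planeMap_eq (hL : IsDualCollection L) {ω : kˣ}
    (hω : IsPrimitiveRoot ω D.r) {P : MvPolynomial (Fin 2) k}
    (hP : P ∈ invariantRing (D.group ω)) {v : Fin 2 →₀ ℕ} (hv : v ∈ P.support) (c : k) :
    ∃ x ∈ weightGrading L k 0, planeMap L k x = MvPolynomial.monomial v c := by
  -- The set of all rays is not a cone of the fan, but its dual semigroup consists of the characters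
  -- regular on all of `X`, so the divisor is effective.
  obtain ⟨hm, hm0⟩ := D.mem_dualSemigroup_of_mem_support hω hP hv Finset.univ
  obtain ⟨d, hd⟩ := exists_intDiv (d := D.charDivHom ⟨_, hm⟩) fun ρ =>
    (D.charDivHom_nonneg_iff _ _).mpr (hm0 ρ (Finset.mem_univ ρ))
  have hdeg : D.divDeg (intDiv d) = 0 := by rw [hd, divDeg_charDivHom]
  obtain ⟨u, rfl⟩ := hL.mem_arrowDivisors (d := d) fun j => by rw [hdeg]; rfl
  have h1 := congrFun hd (Fin.last _)
  have h2 := congrFun hd 0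
  rw [charDivHom_last, intDiv_apply] at h1
  rw [charDivHom_zero_ray, intDiv_apply] at h2
  have hu : (incDiv L u).1 = 0 := by
    rw [← hL.weightOf_incDiv, weightOf_eq_iff _ (by simp), hdeg]
    intro j
    rfl
  refine ⟨_, hu ▸ mk_monomial_mem_weightGrading u c, ?_⟩
  rw [planeMap_mk_monomial, planeMonomial_eq]
  refine congrArg (fun w => MvPolynomial.monomial w c) (Finsupp.ext fun i => ?_)
  fin_cases i
  · simpa using Int.ofNat.inj h1
  · simpa using Int.ofNat.inj h2

lemma IsDualCollection.toInvariants_surjective (hL : IsDualCollection L) {ω : kˣ}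
    (hω : IsPrimitiveRoot ω D.r) : Function.Surjective (hL.toInvariants hω) := by
  intro P
  choose! x hx hx' using fun v (hv : v ∈ P.1.support) =>
    hL.exists_planeMap_eq hω P.2 hv (P.1.coeff v)
  refine ⟨⟨∑ v ∈ P.1.support, x v, Submodule.sum_mem _ hx⟩, Subtype.ext ?_⟩
  change planeMap L k _ = P.1
  rw [map_sum, Finset.sum_congr rfl hx']
  exact P.1.as_sum.symm

/-- The isomorphism of `A_0` with the ring of invariants. -/
def IsDualCollection.invariantsEquiv (hL : IsDualCollection L) {ω : kˣ}
    (hω : IsPrimitiveRoot ω D.r) : weightGrading L k 0 ≃ₐ[k] invariantRing (D.group ω) :=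
  AlgEquiv.ofBijective (hL.toInvariants hω)
    ⟨hL.toInvariants_injective hω, hL.toInvariants_surjective hω⟩

lemma IsDualCollection.awayToCox_fromZeroRingHom (hL : IsDualCollection L) {n : ℕ}
    {d : D.Ray → ℤ} (hd : d ∈ D.sectionDivisors n) {b : SemiInvariantRing L k}
    (hb : b ∈ semiGrading L k 0) :
    hL.awayToCox k hd (HomogeneousLocalization.fromZeroRingHom (semiGrading L k) _ ⟨b, hb⟩) =
      semiCoxMap L k b := by
  have h : HomogeneousLocalization.fromZeroRingHom (semiGrading L k)
      (Submonoid.powers (hL.section k hd)) ⟨b, hb⟩ =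
      HomogeneousLocalization.Away.mk _ (hL.section_mem hd) 0 b (by rwa [zero_smul]) := by
    refine HomogeneousLocalization.val_injective _ ?_
    change Localization.mk b _ = Localization.mk b _
    congr 1
  rw [h, hL.awayToCox_mk, zero_smul, neg_zero, ← AddMonoidAlgebra.one_def, mul_one]

/-- The isomorphism of the toric surface with the GIT quotient identifies the resolution with the
morphism obtained by variation of GIT quotient. -/
lemma IsDualCollection.resolution_comp (hL : IsDualCollection L) {ω : kˣ}
    (hω : IsPrimitiveRoot ω D.r) :
    D.resolution hω ≫ Spec.map (CommRingCat.ofHom (hL.invariantsEquiv hω : _ →+* _)) =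
      hL.toGIT k ≫ toricVariation L k := by
  refine colimit.hom_ext fun s => ?_
  have h1 : colimit.ι (D.chartFunctor k) s ≫ D.resolution hω =
    Spec.map (CommRingCat.ofHom (D.invariantToChart hω s.1).toRingHom) := colimit.ι_desc _ _
  have h2 : colimit.ι (D.chartFunctor k) s ≫ hL.toGIT k = hL.chartToGIT k s := colimit.ι_desc _ _
  have h3 := Proj.awayι_toSpecZero (semiGrading L k) (hL.coneSection k s)
    (hL.section_mem (coneDivisor_mem s)) (coneDegree_pos s)
  have h4 : (Spec.map (CommRingCat.ofHom (hL.awayToChart k s)) ≫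
      Proj.awayι (semiGrading L k) (hL.coneSection k s) (hL.section_mem (coneDivisor_mem s))
        (coneDegree_pos s)) ≫ (Proj.toSpecZero (semiGrading L k) ≫ Spec.map (CommRingCat.ofHom
          (toSemiInvariantsZero (weightGrading L k) (specialWeight D.ℓ)))) =
      Spec.map (CommRingCat.ofHom (((hL.awayToChart k s).comp
        (HomogeneousLocalization.fromZeroRingHom (semiGrading L k) _)).comp
          (toSemiInvariantsZero (weightGrading L k) (specialWeight D.ℓ)))) := by
    rw [Category.assoc, ← Category.assoc (Proj.awayι _ _ _ _), h3, ← Spec.map_comp,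
      ← Spec.map_comp]
    rfl
  refine ((Category.assoc _ _ _).symm.trans ((congrArg (· ≫ Spec.map _) h1).trans ?_)).trans
    (((congrArg (· ≫ toricVariation L k) h2).trans h4).symm.trans (Category.assoc _ _ _))
  refine (Spec.map_comp _ _).symm.trans (congrArg Spec.map ?_)
  -- On each chart the claim is an equality of ring maps out of `A_0`; in the Laurent polynomials
  -- both sides send `x` to its plane polynomial.
  refine CommRingCat.hom_ext (RingHom.ext fun x => D.chartToLaurent_injective s.1 ?_)
  refine (D.chartToLaurent_invariantToChart hω s.1 (hL.invariantsEquiv hω x)).trans ?_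
  refine (toLaurent_planeMap x.1).trans ?_
  rw [← semiCoxMap_zeroToSemi, ← hL.awayToCox_fromZeroRingHom (coneDivisor_mem s)
    (zeroToSemi_mem x), ← hL.chartToCox_awayToChart, coxToLaurent_chartToCox]
  rfl

end CyclicQuotientType

end

theorem mainTheorem5 {k : Type*} [Field k] [IsAlgClosed k] [CharZero k]
    (D : CyclicQuotientType) (ω : kˣ) (hω : IsPrimitiveRoot ω D.r)
    (L : Fin (D.ℓ + 1) → D.Pic) (hL0 : L 0 = 0)
    (hL : ∀ i j : Fin D.ℓ, D.degOn j (L i.succ) = if i = j then 1 else 0) :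
    IsProjectiveMorphism (R := CyclicQuotientType.weightGrading L k 0) (CyclicQuotientType.toricVariation L k) ∧
    ∃ (e : CyclicQuotientType.weightGrading L k 0 ≃ₐ[k] invariantRing (D.group ω))
      (φ : D.toricSurface k ≅ CyclicQuotientType.toricGIT L k),
      (∀ (P : MvPolynomial (CyclicQuotientType.Arrow L) k)
          (z : CyclicQuotientType.weightGrading L k 0),
        Ideal.Quotient.mk (CyclicQuotientType.toricIdeal L k) P = z →
          (e z : MvPolynomial (Fin 2) k) =
            MvPolynomial.aeval (fun b : CyclicQuotientType.Arrow L => D.planeMonomial k b.label) P) ∧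
      D.resolution hω ≫ Spec.map (CommRingCat.ofHom (e : _ →+* _)) =
        φ.hom ≫ CyclicQuotientType.toricVariation L k := by
  have h : CyclicQuotientType.IsDualCollection L := ⟨hL0, hL⟩
  refine ⟨h.isProjectiveMorphism, h.invariantsEquiv hω, asIso (h.toGIT k), fun P z hz => ?_,
    h.resolution_comp hω⟩
  rw [← CyclicQuotientType.planeMap_mk, hz]
  rfl
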